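/- Let $L_2(0,1]$ be the complex Hilbert space of square-integrable functions on $(0,1]$ with Lebesgue measure. Let $G=\chi_{(0,1]}$, $G_{n,k}(x)=2^{n/2}G(2^nx-k)$, $H=(G_{1,0}-G_{1,1})/\sqrt2$ and $H_{n,k}(x)=2^{n/2}H(2^nx-k)$. Put $V_n=\operatorname{span}\{G_{n,k}:0\le k<2^n\}$ and $W_n=\operatorname{span}\{H_{n,k}:0\le k<2^n\}$. Let $\mathcal T_H:L_2(0,1]\to\ell_2$ be the Haar transform, i.e. the unitary map sending $f$ to its coefficients $c_0=\int_0^1 f$ and $c_{n,k}=\int_0^1 fH_{n,k}$ ($n\ge0$, $0\le k<2^n$) with respect to the Haar basis. The basis state $|\epsilon_1\ldots\epsilon_n\rangle$ of $n$ qubits is identified with $G_{n,k}$, where $k=2^n\sum_{j=1}^n\epsilon_j2^{-j}$ (Borel isomorphism). An operation $U|b\rangle=\sum_a U_{ab}|a\rangle$ on the first $n$ qubits acts on functions on $(0,1]$ by translating, for all bit strings $a,b$ of length $n$, the restriction of $f$ to the dyadic interval $(k2^{-n},(k+1)2^{-n}]$ of $b$ to the dyadic interval of $a$, multiplying it by $U_{ab}$,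 and summing. Let $\sigma_+=\begin{pmatrix}0&0\\1&0\end{pmatrix}$ and $\sigma_-=\begin{pmatrix}0&1\\0&0\end{pmatrix}$, let $\sigma_\pm^k$ be the action on functions of $\sigma_\pm$ applied to the $k$-th qubit, and let $$C_\pm[f](x)=\sum_{k=1}^\infty 2^{-k}\,\sigma_\pm^k[f](x),\qquad L[f](x)=\int_0^xf(y)\,dy,\qquad L'[f](x)=\int_x^1f(y)\,dy,$$ $P_-=C_-+L$ and $P_+=C_++L'$. Then for every $f\in L_2(0,1]$ the series $C_\pm[f](x)$ converge absolutely for almost every $x$, and $P_-$, $P_+$ define bounded operators on $L_2(0,1]$ with the following properties. 1. Let $D_-^{(n)}$ be the $2^n\times2^n$ matrix of the compression of $P_-$ to $W_n$ in the basis $(H_{n,k})_{k=0}^{2^n-1}$. Then $[1]\oplus\bigoplus_{n\ge0}D_-^{(n)}$ is a bounded operator on $\ell_2$ and $$P_-=\mathcal T_H^\dagger\Big([1]\oplus\bigoplus_{n=0}^\infty D_-^{(n)}\Big)\mathcal T_H .$$ In particular $P_-V_0=V_0$ and $P_-W_n\subseteq W_n$ for all $n\ge0$. 2. $D_-^{(0)}=[0]$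 and, for $n\ge0$, $D_-^{(n+1)}=\dfrac12\begin{bmatrix}D_-^{(n)}&I\\0&D_-^{(n)}\end{bmatrix}$, where $I$ and $0$ have size $2^n\times2^n$. 3. The same holds for $P_+$: with $D_+^{(n)}$ the matrix of the compression of $P_+$ to $W_n$, the operator $[1]\oplus\bigoplus_{n\ge0}D_+^{(n)}$ is bounded on $\ell_2$, $P_+=\mathcal T_H^\dagger\big([1]\oplus\bigoplus_{n\ge0}D_+^{(n)}\big)\mathcal T_H$, $P_+V_0=V_0$ and $P_+W_n\subseteq W_n$ for all $n\ge0$, $D_+^{(0)}=[0]$, and $D_+^{(n+1)}=\dfrac12\begin{bmatrix}D_+^{(n)}&0\\I&D_+^{(n)}\end{bmatrix}$ for $n\ge0$. 4. $P_-$ and $P_+$ are adjoints of each other. -/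

import Mathlib

open MeasureTheory Set

namespace HaarQubit

noncomputable section

/-! ### The Hilbert space and the Haar system -/

/-- Lebesgue measure on `(0,1]`. -/
abbrev mu : Measure ℝ := volume.restrict (Ioc (0 : ℝ) 1)

/-- The complex Hilbert space `L₂(0,1]`. -/
abbrev L2 : Type := Lp ℂ 2 mu

/-- The function `G`, equal to `1` on `(0,1]` and to `0` elsewhere. -/
def G (x : ℝ) : ℂ := (Ioc (0 : ℝ) 1).indicator (fun _ => (1 : ℂ)) x

/-- `G_{n,k}(x) = 2^{n/2} G(2ⁿ x - k)`. -/
def Gfun (n k : ℕ) (x : ℝ) : ℂ := ((Real.sqrt 2 ^ n : ℝ) : ℂ) * G (2 ^ n * x - k)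

/-- `H = (G_{1,0} - G_{1,1}) / √2`. -/
def H (x : ℝ) : ℂ := (Gfun 1 0 x - Gfun 1 1 x) / ((Real.sqrt 2 : ℝ) : ℂ)

/-- `H_{n,k}(x) = 2^{n/2} H(2ⁿ x - k)`. -/
def Hfun (n k : ℕ) (x : ℝ) : ℂ := ((Real.sqrt 2 ^ n : ℝ) : ℂ) * H (2 ^ n * x - k)

theorem measurable_G : Measurable G :=
  measurable_const.indicator measurableSet_Ioc

theorem norm_G_le (x : ℝ) : ‖G x‖ ≤ 1 := by
  unfold G
  by_cases h : x ∈ Ioc (0 : ℝ) 1 <;> simp [h]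

theorem measurable_Gfun (n k : ℕ) : Measurable (Gfun n k) := by
  unfold Gfun
  exact measurable_const.mul (measurable_G.comp (by fun_prop))

theorem norm_Gfun_le (n k : ℕ) (x : ℝ) : ‖Gfun n k x‖ ≤ Real.sqrt 2 ^ n := by
  unfold Gfun
  rw [norm_mul, Complex.norm_real, Real.norm_of_nonneg (by positivity)]
  exact mul_le_of_le_one_right (by positivity) (norm_G_le _)

theorem measurable_H : Measurable H := by
  unfold H
  exact ((measurable_Gfun 1 0).sub (measurable_Gfun 1 1)).div_const _

theorem norm_H_le (x : ℝ) : ‖H x‖ ≤ 2 := by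
  unfold H
  have h2 : (0 : ℝ) < Real.sqrt 2 := by positivity
  rw [norm_div, Complex.norm_real, Real.norm_of_nonneg h2.le, div_le_iff₀ h2]
  have h0 := norm_Gfun_le 1 0 x
  have h1 := norm_Gfun_le 1 1 x
  have := norm_sub_le (Gfun 1 0 x) (Gfun 1 1 x)
  rw [pow_one] at h0 h1
  linarith

theorem measurable_Hfun (n k : ℕ) : Measurable (Hfun n k) := by
  unfold Hfun
  exact measurable_const.mul (measurable_H.comp (by fun_prop))

theorem norm_Hfun_le (n k : ℕ) (x : ℝ) : ‖Hfun n k x‖ ≤ Real.sqrt 2 ^ n * 2 := by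
  unfold Hfun
  rw [norm_mul, Complex.norm_real, Real.norm_of_nonneg (by positivity)]
  exact mul_le_mul_of_nonneg_left (norm_H_le _) (by positivity)

theorem memLp_Gfun (n k : ℕ) : MemLp (Gfun n k) 2 mu :=
  MemLp.of_bound (measurable_Gfun n k).aestronglyMeasurable _
    (Filter.Eventually.of_forall (norm_Gfun_le n k))

theorem memLp_Hfun (n k : ℕ) : MemLp (Hfun n k) 2 mu :=
  MemLp.of_bound (measurable_Hfun n k).aestronglyMeasurable _
    (Filter.Eventually.of_forall (norm_Hfun_le n k))

/-- `G_{n,k}` as an element of `L₂(0,1]`. -/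
def gVec (n k : ℕ) : L2 := (memLp_Gfun n k).toLp

/-- `H_{n,k}` as an element of `L₂(0,1]`. -/
def hVec (n k : ℕ) : L2 := (memLp_Hfun n k).toLp

/-- `V_n`, the span of the `G_{n,k}` with `0 ≤ k < 2ⁿ`. -/
def V (n : ℕ) : Submodule ℂ L2 := Submodule.span ℂ (Set.range fun k : Fin (2 ^ n) => gVec n k)

/-- `W_n`, the span of the `H_{n,k}` with `0 ≤ k < 2ⁿ`. -/
def W (n : ℕ) : Submodule ℂ L2 := Submodule.span ℂ (Set.range fun k : Fin (2 ^ n) => hVec n k)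

/-- Indices of the Haar basis: `none` stands for `G_{0,0}`, and `some ⟨n, k⟩` for `H_{n,k}`. -/
abbrev HaarIndex : Type := Option (Σ n : ℕ, Fin (2 ^ n))

/-- The Haar functions. -/
def haarFun : HaarIndex → ℝ → ℂ
  | none => Gfun 0 0
  | some ⟨n, k⟩ => Hfun n k

/-- The sequence space `ℓ₂` over the Haar indices. -/
abbrev l2 : Type := lp (fun _ : HaarIndex => ℂ) 2

/-- A unitary map `T : L₂(0,1] → ℓ₂` is the Haar transform if `T f` is the family of the Haar
coefficients of `f`. -/
def IsHaarTransform (T : L2 ≃ₗᵢ[ℂ] l2) : Prop :=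
  ∀ (f : L2) (i : HaarIndex), T f i = ∫ x in Ioc (0 : ℝ) 1, f x * haarFun i x

/-- The matrix, in the orthonormal basis `(H_{n,k})_k` of `W_n`, of the compression of `P`
to `W_n`. -/
def block (P : L2 →L[ℂ] L2) (n : ℕ) : Matrix (Fin (2 ^ n)) (Fin (2 ^ n)) ℂ :=
  Matrix.of fun j k => inner ℂ (hVec n j) (P (hVec n k))

/-- The action of the block diagonal matrix `[1] ⊕ ⨁ₙ D n` on sequences. -/
def blockSum (D : ∀ n : ℕ, Matrix (Fin (2 ^ n)) (Fin (2 ^ n)) ℂ) (c : HaarIndex → ℂ) :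
    HaarIndex → ℂ
  | none => c none
  | some ⟨n, k⟩ => (D n).mulVec (fun j => c (some ⟨n, j⟩)) k

/-- The subdivision of `{0, …, 2ⁿ⁺¹ - 1}` into its first and its second half. -/
def halves (n : ℕ) : Fin (2 ^ n) ⊕ Fin (2 ^ n) ≃ Fin (2 ^ (n + 1)) :=
  finSumFinEquiv.trans (finCongr (by rw [pow_succ, mul_two]))

/-! ### Gates and the Borel isomorphism -/

/-- The dyadic interval `I_{n,k}`. -/
def dyadic (n k : ℕ) : Set ℝ := Ioc ((k : ℝ) / 2 ^ n) (((k : ℝ) + 1) / 2 ^ n)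

/-- The number `k = 2ⁿ ∑_{j=1}^n ε_j / 2^j` of the bit string `ε₁ … εₙ`
(`ε₁` is the most significant bit and is stored at position `0`). -/
def bitIndex {n : ℕ} (e : Fin n → Fin 2) : ℕ := ∑ j, (e j : ℕ) * 2 ^ (j.rev : ℕ)

/-- The Borel isomorphism for `n` qubits, `|ε₁ … εₙ⟩ ↦ G_{n,k}`, where `k` is the number of the
string. A state is given by its coefficients in the basis `|ε₁ … εₙ⟩`. -/
def borel (n : ℕ) (psi : (Fin n → Fin 2) → ℂ) (x : ℝ) : ℂ := ∑ e, psi e * Gfun n (bitIndex e) x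

/-- The action on functions on `(0,1]` of an operation `U` on the first `n` qubits: for
`U |b⟩ = ∑ₐ U a b |a⟩`, the restriction of `f` to the dyadic interval of `b` is translated to the
dyadic interval of each `a` and multiplied by `U a b`. -/
def localAction {n : ℕ} (U : Matrix (Fin n → Fin 2) (Fin n → Fin 2) ℂ) (f : ℝ → ℂ) (x : ℝ) : ℂ :=
  ∑ a, ∑ b, U a b * (dyadic n (bitIndex a)).indicator
    (fun y => f (y + ((bitIndex b : ℝ) - (bitIndex a : ℝ)) / 2 ^ n)) x

theorem bitIndex_injective (n : ℕ) : Function.Injective (bitIndex (n := n)) := by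
  have key : ∀ e : Fin n → Fin 2,
      bitIndex e = (finFunctionFinEquiv (fun j => e j.rev) : Fin (2 ^ n)).val := by
    intro e
    rw [finFunctionFinEquiv_apply]
    exact (Equiv.sum_comp Fin.revPerm (fun j => (e j : ℕ) * 2 ^ (j.rev : ℕ))).symm.trans
      (by simp)
  intro e e' h
  rw [key, key] at h
  have h2 := finFunctionFinEquiv.injective (Fin.ext h)
  funext j
  simpa using congrFun h2 j.rev

theorem Gfun_of_mem {n k l : ℕ} {x : ℝ} (hx : x ∈ dyadic n k) :
    Gfun n l x = if k = l then ((Real.sqrt 2 ^ n : ℝ) : ℂ) else 0 := by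
  have hp : (0 : ℝ) < 2 ^ n := by positivity
  obtain ⟨h1, h2⟩ := hx
  rw [div_lt_iff₀ hp] at h1
  rw [le_div_iff₀ hp] at h2
  unfold Gfun G
  split_ifs with h
  · subst h
    rw [Set.indicator_of_mem, mul_one]
    constructor <;> linarith
  · rw [Set.indicator_of_notMem, mul_zero]
    rintro ⟨h3, h4⟩
    apply h
    have h5 : (k : ℝ) < l + 1 := by linarith
    have h6 : (l : ℝ) < k + 1 := by linarith
    norm_cast at h5 h6
    omega

theorem Gfun_of_notMem {n k : ℕ} {x : ℝ} (hx : x ∉ dyadic n k) : Gfun n k x = 0 := by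
  have hp : (0 : ℝ) < 2 ^ n := by positivity
  unfold Gfun G
  rw [Set.indicator_of_notMem, mul_zero]
  rintro ⟨h3, h4⟩
  apply hx
  constructor
  · rw [div_lt_iff₀ hp]; linarith
  · rw [le_div_iff₀ hp]; linarith

/-- On the functions in `V_n`, `localAction U` is the transport of `U` by the Borel isomorphism. -/
theorem localAction_borel {n : ℕ} (U : Matrix (Fin n → Fin 2) (Fin n → Fin 2) ℂ)
    (psi : (Fin n → Fin 2) → ℂ) : localAction U (borel n psi) = borel n (U.mulVec psi) := by
  have hp : (0 : ℝ) < 2 ^ n := by positivity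
  funext x
  unfold localAction
  conv_rhs => unfold borel
  refine Finset.sum_congr rfl fun a _ => ?_
  by_cases hx : x ∈ dyadic n (bitIndex a)
  · rw [Gfun_of_mem hx, if_pos rfl, Matrix.mulVec, dotProduct, Finset.sum_mul]
    refine Finset.sum_congr rfl fun b _ => ?_
    have hb : x + ((bitIndex b : ℝ) - (bitIndex a : ℝ)) / 2 ^ n ∈ dyadic n (bitIndex b) := by
      obtain ⟨h1, h2⟩ := hx
      unfold dyadic
      rw [sub_div]
      rw [add_div] at h2 ⊢
      constructor <;> linarith
    rw [Set.indicator_of_mem hx, borel, mul_assoc]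
    congr 1
    rw [Finset.sum_eq_single b]
    · rw [Gfun_of_mem hb, if_pos rfl]
    · intro c _ hc
      rw [Gfun_of_mem hb, if_neg (fun h => hc (bitIndex_injective n h).symm), mul_zero]
    · simp
  · rw [Gfun_of_notMem hx, mul_zero]
    exact Finset.sum_eq_zero fun b _ => by rw [Set.indicator_of_notMem hx, mul_zero]

def sigmaPlus : Matrix (Fin 2) (Fin 2) ℂ := !![0, 0; 1, 0]

def sigmaMinus : Matrix (Fin 2) (Fin 2) ℂ := !![0, 1; 0, 0]

/-- The matrix of `I ⊗ … ⊗ I ⊗ s ⊗ I ⊗ … ⊗ I` (`n` factors, `s` at place `i`) in the basis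
`|ε₁ … εₙ⟩`. -/
def onQubit {n : ℕ} (s : Matrix (Fin 2) (Fin 2) ℂ) (i : Fin n) :
    Matrix (Fin n → Fin 2) (Fin n → Fin 2) ℂ :=
  Matrix.of fun a b => ∏ j, (if j = i then s else 1) (a j) (b j)

/-- The gate `s` on the qubit number `k + 1` (counted from `1`), acting on functions on `(0,1]`. -/
def gate (s : Matrix (Fin 2) (Fin 2) ℂ) (k : ℕ) (f : ℝ → ℂ) : ℝ → ℂ :=
  localAction (onQubit s (Fin.last k)) f

/-- The terms `2^{-k} s^k [f](x)`, `k = 1, 2, …`, shifted to start at `0`. -/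
def periodTerm (s : Matrix (Fin 2) (Fin 2) ℂ) (f : ℝ → ℂ) (x : ℝ) (k : ℕ) : ℂ :=
  (1 / 2 ^ (k + 1)) * gate s k f x

/-- The periodization `∑_{k ≥ 1} 2^{-k} s^k` of `s`, acting on functions on `(0,1]`. -/
def period (s : Matrix (Fin 2) (Fin 2) ℂ) (f : ℝ → ℂ) (x : ℝ) : ℂ := ∑' k, periodTerm s f x k

/-- The antiderivative. -/
def antideriv (f : ℝ → ℂ) (x : ℝ) : ℂ := ∫ y in (0 : ℝ)..x, f y

/-- The transpose of the antiderivative. -/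
def antiderivTr (f : ℝ → ℂ) (x : ℝ) : ℂ := ∫ y in x..(1 : ℝ), f y

/-- `P₋ = C₋ + L` on functions. -/
def Pminus (f : ℝ → ℂ) (x : ℝ) : ℂ := period sigmaMinus f x + antideriv f x

/-- `P₊ = C₊ + L'` on functions. -/
def Pplus (f : ℝ → ℂ) (x : ℝ) : ℂ := period sigmaPlus f x + antiderivTr f x

end

end HaarQubit

open HaarQubit

namespace HaarQubit

/-! ### Gates as weighted measure preserving substitutions -/

/-! Everything rests on one self-similarity relation, proved for `haarOp a b`, that is `a P₋ + b
P₊`, so that both operators are treated at once. Write `f₀(y) = f(y/2)` and `f₁(y) = f((y+1)/2)` for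
the two rescaled halves of `f`, and `E` for the mean over `(0,1]`. The first qubit exchanges the
halves, and the later qubits act inside each half as the same series at half the weight. The
antiderivatives rescale likewise, up to the integral over the whole other half. With respect to `f ↦
(f₀, f₁)` the operator is therefore `½ [[P, a + bE], [b + aE, P]]` (`haarOp_left`, `haarOp_right`).

If `a + b = 1`, this relation forces `P 1 = 1` (`haarOp_const_one`) and then `P H = 0` (`haarOp_H`).
A Haar function of level `n + 1` is `√2` times one of level `n` placed on one half. Its mean is
zero, so the `E` terms drop out and the relation becomes the recurrence for the blocks
(`haarOp_Hfun`).

For boundedness, each gate is a substitution that preserves Lebesgue measure, times a weight of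
modulus at most one, so `C±` is a norm-convergent series; `L` and `L'` are contractions. Since the
Haar functions form a Hilbert basis (`haarBasis`), a bounded operator is determined by its values on
them. Adjointness then reduces to the fact that conjugate transposition of the blocks exchanges the
pairs `(1, 0)` and `(0, 1)` of coefficients. -/

theorem bitIndex_snoc {k : ℕ} (e : Fin k → Fin 2) (i : Fin 2) :
    bitIndex (Fin.snoc e i : Fin (k + 1) → Fin 2) = 2 * bitIndex e + i := by
  unfold bitIndex
  rw [Fin.sum_univ_castSucc, Finset.mul_sum]
  simp only [Fin.snoc_castSucc, Fin.snoc_last, Fin.rev_last, Fin.rev_castSucc, Fin.val_succ,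
    Fin.val_zero, pow_zero, mul_one, add_left_inj]
  exact Finset.sum_congr rfl fun j _ => by rw [pow_succ]; ring

theorem exists_bitIndex_eq {n m : ℕ} (hm : m < 2 ^ n) : ∃ e : Fin n → Fin 2, bitIndex e = m := by
  induction n generalizing m with
  | zero => exact ⟨0, by simp [bitIndex] at hm ⊢; omega⟩
  | succ n ih =>
    rw [pow_succ] at hm
    obtain ⟨e, he⟩ := ih (m := m / 2) (by omega)
    refine ⟨Fin.snoc e ⟨m % 2, by omega⟩, ?_⟩
    rw [bitIndex_snoc, he]
    simp only
    omega

theorem onQubit_last_snoc {k : ℕ} (s : Matrix (Fin 2) (Fin 2) ℂ) (e e' : Fin k → Fin 2)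
    (i j : Fin 2) :
    onQubit s (Fin.last k) (Fin.snoc e i) (Fin.snoc e' j) = if e = e' then s i j else 0 := by
  simp only [onQubit, Matrix.of_apply]
  rw [Fin.prod_univ_castSucc]
  simp only [Fin.snoc_castSucc, Fin.snoc_last, if_true, (Fin.castSucc_lt_last _).ne, if_false]
  by_cases h : e = e'
  · subst h; simp
  · rw [if_neg h]
    obtain ⟨l, hl⟩ := Function.ne_iff.mp h
    rw [Finset.prod_eq_zero (Finset.mem_univ l) (by simp [hl]), zero_mul]

theorem sum_snoc {k : ℕ} (F : (Fin (k + 1) → Fin 2) → ℂ) :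
    ∑ a, F a = ∑ i : Fin 2, ∑ e : Fin k → Fin 2, F (Fin.snoc e i) := by
  rw [← (Fin.snocEquiv (fun _ : Fin (k + 1) => Fin 2)).sum_comp, Fintype.sum_prod_type]
  rfl

/-- The intervals are open on the left and closed on the right, hence the ceiling and the shift by
one. An even interval number corresponds to an odd ceiling. -/
theorem mem_dyadic_iff {n m : ℕ} {x : ℝ} : x ∈ dyadic n m ↔ ⌈2 ^ n * x⌉ = (m : ℤ) + 1 := by
  have hp : (0 : ℝ) < 2 ^ n := by positivity
  rw [Int.ceil_eq_iff, dyadic, mem_Ioc, div_lt_iff₀ hp, le_div_iff₀ hp]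
  push_cast
  constructor <;> rintro ⟨h1, h2⟩ <;> constructor <;> linarith

theorem exists_mem_dyadic (n : ℕ) {x : ℝ} (hx : x ∈ Ioc (0 : ℝ) 1) :
    ∃ m < 2 ^ n, x ∈ dyadic n m := by
  have hp : (0 : ℝ) < 2 ^ n := by positivity
  have h1 : 0 < ⌈2 ^ n * x⌉ := Int.ceil_pos.mpr (mul_pos hp hx.1)
  have h2 : ⌈2 ^ n * x⌉ ≤ ((2 ^ n : ℕ) : ℤ) := by
    rw [Int.ceil_le]; push_cast
    exact mul_le_of_le_one_right hp.le hx.2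
  refine ⟨(⌈2 ^ n * x⌉ - 1).toNat, by omega, mem_dyadic_iff.mpr (by omega)⟩

/-- The position of `x` selects a single row string, and the gate preserves its first `k` bits. Only
the two columns differing in the last bit survive, and these belong to the two halves of the same
interval of length `2⁻ᵏ`. -/
theorem gate_of_mem_dyadic (s : Matrix (Fin 2) (Fin 2) ℂ) (f : ℝ → ℂ) {k m : ℕ} {i : Fin 2}
    {x : ℝ} (hm : m < 2 ^ k) (hx : x ∈ dyadic (k + 1) (2 * m + i)) :
    gate s k f x = ∑ j : Fin 2, s i j * f (x + ((j : ℝ) - (i : ℝ)) / 2 ^ (k + 1)) := by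
  obtain ⟨e, rfl⟩ := exists_bitIndex_eq hm
  rw [← bitIndex_snoc] at hx
  unfold gate localAction
  rw [Finset.sum_eq_single (Fin.snoc e i : Fin (k + 1) → Fin 2)]
  · rw [sum_snoc]
    refine Finset.sum_congr rfl fun j _ => ?_
    rw [Finset.sum_eq_single e]
    · rw [onQubit_last_snoc, if_pos rfl, indicator_of_mem hx, bitIndex_snoc, bitIndex_snoc]
      push_cast
      ring_nf
    · intro e' _ he'
      rw [onQubit_last_snoc, if_neg he'.symm, zero_mul]
    · simp
  · intro a _ ha
    refine Finset.sum_eq_zero fun b _ => ?_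
    rw [indicator_of_notMem, mul_zero]
    intro hxa
    rw [mem_dyadic_iff] at hx hxa
    exact ha (bitIndex_injective _ (by omega))
  · simp

/-- The matrix `a σ₋ + b σ₊`. -/
def offDiag (a b : ℂ) : Matrix (Fin 2) (Fin 2) ℂ := !![0, a; b, 0]

/-- The number of the dyadic interval of length `2⁻ᵏ⁻¹` of `x` is even: the qubit `k + 1` is `0`. -/
def BitZero (k : ℕ) (x : ℝ) : Prop := Odd ⌈2 ^ (k + 1) * x⌉

open Classical in
/-- The exchange of the two halves of each dyadic interval of length `2⁻ᵏ`. -/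
noncomputable def swap (k : ℕ) (x : ℝ) : ℝ :=
  if BitZero k x then x + 1 / 2 ^ (k + 1) else x - 1 / 2 ^ (k + 1)

open Classical in
/-- The function equal to `a` where the qubit `k + 1` is `0`, and to `b` elsewhere. -/
noncomputable def weight (a b : ℂ) (k : ℕ) (x : ℝ) : ℂ := if BitZero k x then a else b

/-- The restriction to `(0,1]` matters: elsewhere the gate gives `0`, while `swap` and `weight` are
defined by parity on the whole line. -/
theorem gate_offDiag (a b : ℂ) (k : ℕ) (f : ℝ → ℂ) {x : ℝ} (hx : x ∈ Ioc (0 : ℝ) 1) :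
    gate (offDiag a b) k f x = weight a b k x * f (swap k x) := by
  obtain ⟨m, hm, hxm⟩ := exists_mem_dyadic (k + 1) hx
  rw [pow_succ] at hm
  have hc := mem_dyadic_iff.mp hxm
  unfold weight swap BitZero
  rcases Nat.even_or_odd' m with ⟨l, rfl | rfl⟩
  · rw [gate_of_mem_dyadic (i := 0) _ _ (m := l) (by omega) (by simpa using hxm)]
    have : Odd ⌈2 ^ (k + 1) * x⌉ := by rw [hc]; exact ⟨l, by push_cast; ring⟩
    simp [this, offDiag]
  · rw [gate_of_mem_dyadic (i := 1) _ _ (m := l) (by omega) (by simpa using hxm)]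
    have : ¬ Odd ⌈2 ^ (k + 1) * x⌉ := by
      rw [hc, Int.not_odd_iff_even]; exact ⟨l + 1, by push_cast; ring⟩
    simp [this, offDiag, sub_eq_add_neg, neg_div]

theorem norm_weight_le {a b : ℂ} (ha : ‖a‖ ≤ 1) (hb : ‖b‖ ≤ 1) (k : ℕ) (x : ℝ) :
    ‖weight a b k x‖ ≤ 1 := by
  unfold weight; split_ifs <;> assumption

theorem measurableSet_bitZero (k : ℕ) : MeasurableSet {x | BitZero k x} := by
  have h : Measurable fun x : ℝ => ⌈2 ^ (k + 1) * x⌉ := Int.measurable_ceil.comp (by fun_prop)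
  exact h (MeasurableSet.of_discrete (s := {n : ℤ | Odd n}))

theorem measurable_weight (a b : ℂ) (k : ℕ) : Measurable (weight a b k) := by
  unfold weight
  exact Measurable.ite (measurableSet_bitZero k) measurable_const measurable_const

theorem measurable_swap (k : ℕ) : Measurable (swap k) := by
  unfold swap
  exact Measurable.ite (measurableSet_bitZero k) (by fun_prop) (by fun_prop)

theorem ceil_add_step (k : ℕ) (x : ℝ) :
    ⌈2 ^ (k + 1) * (x + 1 / 2 ^ (k + 1))⌉ = ⌈2 ^ (k + 1) * x⌉ + 1 := by
  rw [mul_add, mul_one_div_cancel (by positivity), Int.ceil_add_one]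

theorem bitZero_add_step (k : ℕ) (x : ℝ) : BitZero k (x + 1 / 2 ^ (k + 1)) ↔ ¬ BitZero k x := by
  unfold BitZero
  rw [ceil_add_step]
  grind

/-- The bound is written `2 * 2 ^ k` to make its parity visible: an odd ceiling cannot attain it, so
a step to the right from a left half stays in `(0,1]`. -/
theorem mem_Ioc_iff_ceil (k : ℕ) (x : ℝ) :
    x ∈ Ioc (0 : ℝ) 1 ↔ 0 < ⌈2 ^ (k + 1) * x⌉ ∧ ⌈2 ^ (k + 1) * x⌉ ≤ 2 * 2 ^ k := by
  have hp : (0 : ℝ) < 2 ^ (k + 1) := by positivity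
  rw [Int.ceil_pos, Int.ceil_le, mem_Ioc, mul_pos_iff_of_pos_left hp]
  push_cast
  rw [← pow_succ', mul_le_iff_le_one_right hp]

theorem mem_Ioc_add_step {k : ℕ} {x : ℝ} (hx : BitZero k x) :
    x + 1 / 2 ^ (k + 1) ∈ Ioc (0 : ℝ) 1 ↔ x ∈ Ioc (0 : ℝ) 1 := by
  rw [mem_Ioc_iff_ceil k, mem_Ioc_iff_ceil k, ceil_add_step]
  obtain ⟨l, hl⟩ := hx
  rw [hl]
  omega

theorem swap_mem {k : ℕ} {x : ℝ} (hx : x ∈ Ioc (0 : ℝ) 1) : swap k x ∈ Ioc (0 : ℝ) 1 := by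
  unfold swap
  split_ifs with h
  · exact (mem_Ioc_add_step h).mpr hx
  · rw [← mem_Ioc_add_step, sub_add_cancel]
    · exact hx
    · have := bitZero_add_step k (x - 1 / 2 ^ (k + 1))
      rw [sub_add_cancel] at this
      tauto

theorem measurePreserving_swap (k : ℕ) : MeasurePreserving (swap k) mu mu := by
  refine ⟨measurable_swap k, Measure.ext fun S hS => ?_⟩
  set c : ℝ := 1 / 2 ^ (k + 1) with hc
  set O : Set ℝ := {x | BitZero k x} with hO
  have hOm : MeasurableSet O := measurableSet_bitZero k
  rw [Measure.map_apply (measurable_swap k) hS, Measure.restrict_apply (measurable_swap k hS),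
    Measure.restrict_apply hS, ← measure_inter_add_sdiff (_ ∩ _) hOm,
    ← measure_inter_add_sdiff (S ∩ _) hOm, add_comm]
  -- The pieces are matched crosswise, since `swap` carries `O` to its complement and back. Both
  -- identities use the same translation `x ↦ x + c`, so translation invariance finishes the proof.
  have h1 : (swap k ⁻¹' S ∩ Ioc 0 1) ∩ O = (fun x => x + c) ⁻¹' ((S ∩ Ioc 0 1) \ O) := by
    ext x
    simp only [mem_inter_iff, mem_preimage, mem_sdiff, hO, mem_ofPred_eq, hc, bitZero_add_step,
      not_not]
    constructor
    · rintro ⟨⟨h, h'⟩, h''⟩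
      exact ⟨⟨by simpa [swap, h''] using h, (mem_Ioc_add_step h'').mpr h'⟩, h''⟩
    · rintro ⟨⟨h, h'⟩, h''⟩
      exact ⟨⟨by simpa [swap, h''] using h, (mem_Ioc_add_step h'').mp h'⟩, h''⟩
  have h2 : (S ∩ Ioc 0 1) ∩ O = (fun x => x + c) ⁻¹' ((swap k ⁻¹' S ∩ Ioc 0 1) \ O) := by
    ext x
    simp only [mem_inter_iff, mem_preimage, mem_sdiff, hO, mem_ofPred_eq, hc, bitZero_add_step,
      not_not]
    have h0 : BitZero k x → swap k (x + 1 / 2 ^ (k + 1)) = x := by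
      intro h
      rw [swap, if_neg (by rw [bitZero_add_step]; exact not_not.mpr h), add_sub_cancel_right]
    constructor
    · rintro ⟨⟨h, h'⟩, h''⟩
      exact ⟨⟨by rwa [h0 h''], (mem_Ioc_add_step h'').mpr h'⟩, h''⟩
    · rintro ⟨⟨h, h'⟩, h''⟩
      exact ⟨⟨by rwa [h0 h''] at h, (mem_Ioc_add_step h'').mp h'⟩, h''⟩
  rw [h1, h2, measure_preimage_add_right, measure_preimage_add_right]

/-! ### Bounded operators on `L₂(0,1]` given by formulas -/

/-- A linear operation on square integrable functions that does not increase the norm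
defines a contraction of `L₂(0,1]`. -/
theorem exists_contraction (op : (ℝ → ℂ) → ℝ → ℂ)
    (hadd : ∀ f g, MemLp f 2 mu → MemLp g 2 mu → op (f + g) =ᵐ[mu] op f + op g)
    (hsmul : ∀ (c : ℂ) f, MemLp f 2 mu → op (c • f) =ᵐ[mu] c • op f)
    (hmeas : ∀ f, MemLp f 2 mu → AEStronglyMeasurable (op f) mu)
    (hbound : ∀ f, MemLp f 2 mu → eLpNorm (op f) 2 mu ≤ eLpNorm f 2 mu) :
    ∃ A : L2 →L[ℂ] L2, ‖A‖ ≤ 1 ∧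
      ∀ (f : ℝ → ℂ) (hf : MemLp f 2 mu), (A hf.toLp : ℝ → ℂ) =ᵐ[mu] op f := by
  have hmem : ∀ f, MemLp f 2 mu → MemLp (op f) 2 mu := fun f hf =>
    ⟨hmeas f hf, (hbound f hf).trans_lt hf.2⟩
  -- Independence of the representative comes from the bound: `op (f - g)` has norm zero as soon as
  -- `f - g` does.
  have hcongr : ∀ f g, MemLp f 2 mu → MemLp g 2 mu → f =ᵐ[mu] g → op f =ᵐ[mu] op g := by
    intro f g hf hg hfg
    have h0 : op (f - g) =ᵐ[mu] 0 := by
      rw [← eLpNorm_eq_zero_iff (hmeas _ (hf.sub hg)) two_ne_zero]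
      refine le_antisymm ((hbound _ (hf.sub hg)).trans ?_) zero_le
      rw [eLpNorm_congr_ae (hfg.sub (Filter.EventuallyEq.refl _ g))]
      simp
    have h1 := hadd g (f - g) hg (hf.sub hg)
    rw [add_sub_cancel] at h1
    filter_upwards [h0, h1] with x hx0 hx1
    rw [hx1, Pi.add_apply, hx0, Pi.zero_apply, add_zero]
  let A : L2 →ₗ[ℂ] L2 :=
    { toFun := fun f => (hmem f (Lp.memLp f)).toLp
      map_add' := fun f g => by
        rw [← MemLp.toLp_add, MemLp.toLp_eq_toLp_iff]
        exact (hcongr _ _ (Lp.memLp _) ((Lp.memLp f).add (Lp.memLp g)) (Lp.coeFn_add f g)).trans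
          (hadd _ _ (Lp.memLp f) (Lp.memLp g))
      map_smul' := fun c f => by
        rw [RingHom.id_apply, ← MemLp.toLp_const_smul, MemLp.toLp_eq_toLp_iff]
        exact (hcongr _ _ (Lp.memLp _) ((Lp.memLp f).const_smul c) (Lp.coeFn_smul c f)).trans
          (hsmul c _ (Lp.memLp f)) }
  have hA : ∀ f, ‖A f‖ ≤ 1 * ‖f‖ := by
    intro f
    rw [one_mul]
    change ‖(hmem f (Lp.memLp f)).toLp‖ ≤ ‖f‖
    rw [Lp.norm_toLp, Lp.norm_def]
    exact ENNReal.toReal_mono (Lp.memLp f).2.ne (hbound f (Lp.memLp f))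
  refine ⟨A.mkContinuous 1 hA, A.mkContinuous_norm_le zero_le_one hA, fun f hf => ?_⟩
  exact (hmem _ (Lp.memLp hf.toLp)).coeFn_toLp.trans (hcongr _ _ (Lp.memLp _) hf hf.coeFn_toLp)

theorem exists_gate {a b : ℂ} (ha : ‖a‖ ≤ 1) (hb : ‖b‖ ≤ 1) (k : ℕ) :
    ∃ A : L2 →L[ℂ] L2, ‖A‖ ≤ 1 ∧ ∀ (f : ℝ → ℂ) (hf : MemLp f 2 mu),
      (A hf.toLp : ℝ → ℂ) =ᵐ[mu] gate (offDiag a b) k f := by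
  have key : ∀ f, gate (offDiag a b) k f =ᵐ[mu] fun x => weight a b k x * f (swap k x) :=
    fun f => (ae_restrict_mem measurableSet_Ioc).mono fun x hx => gate_offDiag a b k f hx
  obtain ⟨A, hA, hAf⟩ := exists_contraction (fun f x => weight a b k x * f (swap k x))
    (fun f g _ _ => .of_forall fun x => by simp [mul_add])
    (fun c f _ => .of_forall fun x => by simp [mul_left_comm])
    (fun f hf => (measurable_weight a b k).aestronglyMeasurable.mul
      (hf.1.comp_measurePreserving (measurePreserving_swap k)))
    (fun f hf => by
      rw [← eLpNorm_comp_measurePreserving hf.1 (measurePreserving_swap k)]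
      refine eLpNorm_mono fun x => ?_
      rw [norm_mul]
      exact mul_le_of_le_one_left (norm_nonneg _) (norm_weight_le ha hb k x))
  exact ⟨A, hA, fun f hf => (hAf f hf).trans (key f).symm⟩

/-- The gates are contractions, so the weights `2⁻ᵏ⁻¹` make the series converge in operator norm.
Summability of the `L₂` norms of its terms also gives summability at almost every point, with the
same sum (`Lp.hasSum_coeFn_tsum`). -/
theorem exists_period {a b : ℂ} (ha : ‖a‖ ≤ 1) (hb : ‖b‖ ≤ 1) :
    ∃ A : L2 →L[ℂ] L2, ∀ (f : ℝ → ℂ) (hf : MemLp f 2 mu),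
      (∀ᵐ x ∂mu, Summable (periodTerm (offDiag a b) f x)) ∧
      (A hf.toLp : ℝ → ℂ) =ᵐ[mu] period (offDiag a b) f := by
  choose E hE hEf using fun k => exists_gate ha hb k
  have hsum : Summable fun k => (1 / 2 : ℝ) ^ (k + 1) :=
    (summable_nat_add_iff 1).mpr summable_geometric_two
  have hnorm : ∀ k, ‖((1 / 2 : ℂ) ^ (k + 1)) • E k‖ ≤ (1 / 2 : ℝ) ^ (k + 1) := fun k => by
    rw [norm_smul, norm_pow]
    refine (mul_le_of_le_one_right (by positivity) (hE k)).trans_eq ?_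
    norm_num
  have hs : Summable fun k => ((1 / 2 : ℂ) ^ (k + 1)) • E k := .of_norm_bounded hsum hnorm
  refine ⟨∑' k, ((1 / 2 : ℂ) ^ (k + 1)) • E k, fun f hf => ?_⟩
  have happ : (∑' k, ((1 / 2 : ℂ) ^ (k + 1)) • E k) hf.toLp
      = ∑' k, ((1 / 2 : ℂ) ^ (k + 1)) • E k hf.toLp :=
    ((ContinuousLinearMap.apply ℂ L2 hf.toLp).hasSum hs.hasSum).tsum_eq.symm
  have hfin : ∑' k, ‖((1 / 2 : ℂ) ^ (k + 1)) • E k hf.toLp‖ₑ ≠ ⊤ := by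
    rw [tsum_enorm_ne_top_iff_summable_norm]
    refine Summable.of_nonneg_of_le (fun _ => norm_nonneg _) (fun k => ?_)
      (hsum.mul_right ‖hf.toLp‖)
    exact (((1 / 2 : ℂ) ^ (k + 1)) • E k).le_of_opNorm_le (hnorm k) _
  have hterm : ∀ᵐ x ∂mu, ∀ k, (((1 / 2 : ℂ) ^ (k + 1)) • E k hf.toLp : L2) x
      = periodTerm (offDiag a b) f x k := by
    rw [ae_all_iff]
    intro k
    filter_upwards [Lp.coeFn_smul ((1 / 2 : ℂ) ^ (k + 1)) (E k hf.toLp), hEf k f hf] with x h1 h2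
    rw [h1, Pi.smul_apply, h2, periodTerm, smul_eq_mul, one_div_pow]
  have hae := Lp.hasSum_coeFn_tsum hfin
  rw [← happ] at hae
  constructor
  · filter_upwards [hae, hterm] with x h1 h2
    exact h1.summable.congr fun k => (h2 k)
  · filter_upwards [hae, hterm] with x h1 h2
    rw [← h1.tsum_eq, period]
    exact tsum_congr h2

theorem _root_.MeasureTheory.MemLp.integrable_mu {f : ℝ → ℂ} (hf : MemLp f 2 mu) :
    IntegrableOn f (Ioc 0 1) := hf.integrable (by norm_num)

theorem intervalIntegrable_of_mem {f : ℝ → ℂ} (hf : IntegrableOn f (Ioc 0 1)) {x y : ℝ}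
    (hx : x ∈ Icc (0 : ℝ) 1) (hy : y ∈ Icc (0 : ℝ) 1) : IntervalIntegrable f volume x y := by
  have h : IntervalIntegrable f volume 0 1 :=
    (intervalIntegrable_iff_integrableOn_Ioc_of_le zero_le_one).mpr hf
  refine h.mono_set ?_
  rw [uIcc_of_le (zero_le_one (α := ℝ))]
  exact uIcc_subset_Icc hx hy

/-- Integration between endpoints that depend continuously on `x` is a contraction. -/
theorem exists_integral {u v : ℝ → ℝ} (hu : Continuous u) (hv : Continuous v)
    (hum : ∀ x ∈ Ioc (0 : ℝ) 1, u x ∈ Icc (0 : ℝ) 1)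
    (hvm : ∀ x ∈ Ioc (0 : ℝ) 1, v x ∈ Icc (0 : ℝ) 1) :
    ∃ A : L2 →L[ℂ] L2, ∀ (f : ℝ → ℂ) (hf : MemLp f 2 mu),
      (A hf.toLp : ℝ → ℂ) =ᵐ[mu] fun x => ∫ y in u x..v x, f y := by
  have hI : ∀ {f : ℝ → ℂ}, MemLp f 2 mu → ∀ x ∈ Ioc (0 : ℝ) 1,
      IntervalIntegrable f volume (u x) (v x) := fun hf x hx =>
    intervalIntegrable_of_mem hf.integrable_mu (hum x hx) (hvm x hx)
  have hprob : IsProbabilityMeasure mu := ⟨by simp⟩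
  have hmeas : ∀ f : ℝ → ℂ, MemLp f 2 mu →
      AEStronglyMeasurable (fun x => ∫ y in u x..v x, f y) mu := by
    intro f hf
    refine ContinuousOn.aestronglyMeasurable ?_ measurableSet_Ioc
    have hc : ContinuousOn (fun x => ∫ y in (0 : ℝ)..x, f y) (Icc 0 1) := by
      have := intervalIntegral.continuousOn_primitive_interval' (μ := volume) (f := f) (a := 0)
        (b₁ := 0) (b₂ := 1)
        (intervalIntegrable_of_mem hf.integrable_mu (by simp) (by simp)) (by simp)
      rwa [uIcc_of_le (zero_le_one (α := ℝ))] at this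
    refine ((hc.comp hv.continuousOn hvm).sub (hc.comp hu.continuousOn hum)).congr fun x hx => ?_
    exact (intervalIntegral.integral_interval_sub_left
      (intervalIntegrable_of_mem hf.integrable_mu (by simp) (hvm x hx))
      (intervalIntegrable_of_mem hf.integrable_mu (by simp) (hum x hx))).symm
  have hbound : ∀ f : ℝ → ℂ, MemLp f 2 mu →
      eLpNorm (fun x => ∫ y in u x..v x, f y) 2 mu ≤ eLpNorm f 2 mu := by
    intro f hf
    -- The result is bounded pointwise by the `L₁` norm of `f`, which on a probability space is at
    -- most its `L₂` norm.
    have h1 : ∀ᵐ x ∂mu, ‖∫ y in u x..v x, f y‖ ≤ ∫ y in Ioc (0 : ℝ) 1, ‖f y‖ := by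
      filter_upwards [ae_restrict_mem measurableSet_Ioc] with x hx
      refine intervalIntegral.norm_integral_le_integral_norm_uIoc.trans ?_
      refine setIntegral_mono_set hf.integrable_mu.norm (.of_forall fun _ => norm_nonneg _)
        (LE.le.eventuallyLE ?_)
      intro y hy
      have h0 := hum x hx
      have h0' := hvm x hx
      exact ⟨(le_min h0.1 h0'.1).trans_lt hy.1, hy.2.trans (max_le h0.2 h0'.2)⟩
    refine (eLpNorm_le_of_ae_bound h1).trans ?_
    rw [measure_univ, ENNReal.one_rpow, one_mul,
      ofReal_integral_norm_eq_lintegral_enorm hf.integrable_mu, ← eLpNorm_one_eq_lintegral_enorm]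
    exact eLpNorm_le_eLpNorm_of_exponent_le (by norm_num) hf.1
  obtain ⟨A, -, hA⟩ := exists_contraction (fun f x => ∫ y in u x..v x, f y)
    (fun f g hf hg => by
      filter_upwards [ae_restrict_mem measurableSet_Ioc] with x hx
      exact intervalIntegral.integral_add (hI hf x hx) (hI hg x hx))
    (fun c f _ => .of_forall fun x => intervalIntegral.integral_smul c f) hmeas hbound
  exact ⟨A, hA⟩

/-! ### Self-similarity -/

theorem bitZero_succ_left (k : ℕ) (x : ℝ) : BitZero (k + 1) x ↔ BitZero k (2 * x) := by
  unfold BitZero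
  rw [pow_succ _ (k + 1), mul_assoc]

/-- Passing to `2 * x - 1` shifts the ceiling by the even integer `2 * 2 ^ k`, which leaves its
parity unchanged. -/
theorem bitZero_succ_right (k : ℕ) (x : ℝ) : BitZero (k + 1) x ↔ BitZero k (2 * x - 1) := by
  unfold BitZero
  have h : (2 : ℝ) ^ (k + 1) * (2 * x - 1) = 2 ^ (k + 1 + 1) * x - ((2 * 2 ^ k : ℤ) : ℝ) := by
    push_cast; ring
  rw [h, Int.ceil_sub_intCast, Int.odd_sub]
  simp

theorem swap_succ_left (k : ℕ) (x : ℝ) : swap (k + 1) x = swap k (2 * x) / 2 := by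
  have hb := bitZero_succ_left k x
  unfold swap
  by_cases h : BitZero k (2 * x)
  · rw [if_pos (hb.mpr h), if_pos h]; field_simp; ring
  · rw [if_neg (mt hb.mp h), if_neg h]; field_simp; ring

theorem weight_succ_left (a b : ℂ) (k : ℕ) (x : ℝ) :
    weight a b (k + 1) x = weight a b k (2 * x) := by
  have hb := bitZero_succ_left k x
  unfold weight
  by_cases h : BitZero k (2 * x)
  · rw [if_pos (hb.mpr h), if_pos h]
  · rw [if_neg (mt hb.mp h), if_neg h]

theorem swap_succ_right (k : ℕ) (x : ℝ) : swap (k + 1) x = (swap k (2 * x - 1) + 1) / 2 := by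
  have hb := bitZero_succ_right k x
  unfold swap
  by_cases h : BitZero k (2 * x - 1)
  · rw [if_pos (hb.mpr h), if_pos h]; field_simp; ring
  · rw [if_neg (mt hb.mp h), if_neg h]; field_simp; ring

theorem weight_succ_right (a b : ℂ) (k : ℕ) (x : ℝ) :
    weight a b (k + 1) x = weight a b k (2 * x - 1) := by
  have hb := bitZero_succ_right k x
  unfold weight
  by_cases h : BitZero k (2 * x - 1)
  · rw [if_pos (hb.mpr h), if_pos h]
  · rw [if_neg (mt hb.mp h), if_neg h]

theorem bitZero_zero_left {x : ℝ} (hx : x ∈ Ioc (0 : ℝ) (1 / 2)) : BitZero 0 x := by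
  unfold BitZero
  have : ⌈(2 : ℝ) ^ (0 + 1) * x⌉ = 1 := by
    rw [Int.ceil_eq_iff]
    norm_num
    constructor <;> linarith [hx.1, hx.2]
  rw [this]; exact odd_one

theorem bitZero_zero_right {x : ℝ} (hx : x ∈ Ioc (1 / 2 : ℝ) 1) : ¬ BitZero 0 x := by
  unfold BitZero
  have : ⌈(2 : ℝ) ^ (0 + 1) * x⌉ = 2 := by
    rw [Int.ceil_eq_iff]
    norm_num
    constructor <;> linarith [hx.1, hx.2]
  rw [this]; decide

theorem periodTerm_offDiag (a b : ℂ) (f : ℝ → ℂ) (k : ℕ) {x : ℝ} (hx : x ∈ Ioc (0 : ℝ) 1) :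
    periodTerm (offDiag a b) f x k = 1 / 2 ^ (k + 1) * (weight a b k x * f (swap k x)) := by
  rw [periodTerm, gate_offDiag a b k f hx]

theorem norm_periodTerm_le {a b : ℂ} (ha : ‖a‖ ≤ 1) (hb : ‖b‖ ≤ 1) {f : ℝ → ℂ} {C : ℝ}
    (hC : ∀ x, ‖f x‖ ≤ C) {x : ℝ} (hx : x ∈ Ioc (0 : ℝ) 1) (k : ℕ) :
    ‖periodTerm (offDiag a b) f x k‖ ≤ C / 2 / 2 ^ k := by
  rw [periodTerm_offDiag a b f k hx, norm_mul, norm_mul, norm_div, norm_pow]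
  have h := mul_le_of_le_one_left (norm_nonneg (f (swap k x))) (norm_weight_le ha hb k x)
  have h2 := h.trans (hC _)
  rw [norm_one, Complex.norm_ofNat, div_div, ← pow_succ', one_div_mul_eq_div]
  gcongr

theorem summable_periodTerm {a b : ℂ} (ha : ‖a‖ ≤ 1) (hb : ‖b‖ ≤ 1) {f : ℝ → ℂ} {C : ℝ}
    (hC : ∀ x, ‖f x‖ ≤ C) {x : ℝ} (hx : x ∈ Ioc (0 : ℝ) 1) :
    Summable (periodTerm (offDiag a b) f x) :=
  .of_norm_bounded (summable_geometric_two' C) (norm_periodTerm_le ha hb hC hx)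

theorem norm_period_le {a b : ℂ} (ha : ‖a‖ ≤ 1) (hb : ‖b‖ ≤ 1) {f : ℝ → ℂ} {C : ℝ}
    (hC : ∀ x, ‖f x‖ ≤ C) {x : ℝ} (hx : x ∈ Ioc (0 : ℝ) 1) :
    ‖period (offDiag a b) f x‖ ≤ C :=
  tsum_of_norm_bounded (hasSum_geometric_two' C) (norm_periodTerm_le ha hb hC hx)

theorem left_mem {x : ℝ} (hx : x ∈ Ioc (0 : ℝ) (1 / 2)) : 2 * x ∈ Ioc (0 : ℝ) 1 :=
  ⟨by linarith [hx.1], by linarith [hx.2]⟩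

theorem right_mem {x : ℝ} (hx : x ∈ Ioc (1 / 2 : ℝ) 1) : 2 * x - 1 ∈ Ioc (0 : ℝ) 1 :=
  ⟨by linarith [hx.1], by linarith [hx.2]⟩

theorem left_subset : Ioc (0 : ℝ) (1 / 2) ⊆ Ioc 0 1 := Ioc_subset_Ioc_right (by norm_num)

theorem right_subset : Ioc (1 / 2 : ℝ) 1 ⊆ Ioc 0 1 := Ioc_subset_Ioc_left (by norm_num)

/-- The first term exchanges the two halves of `(0,1]`; the tail is the same series for the rescaled
half, with an extra factor `1/2`. A uniform bound on `f` gives summability at every point, so the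
relation holds without exceptional sets and can be iterated. -/
theorem period_left {a b : ℂ} (ha : ‖a‖ ≤ 1) (hb : ‖b‖ ≤ 1) {f : ℝ → ℂ} {C : ℝ}
    (hC : ∀ x, ‖f x‖ ≤ C) {x : ℝ} (hx : x ∈ Ioc (0 : ℝ) (1 / 2)) :
    period (offDiag a b) f x = a * f (x + 1 / 2) / 2
      + period (offDiag a b) (fun y => f (y / 2)) (2 * x) / 2 := by
  have hx' := left_subset hx
  unfold period
  rw [(summable_periodTerm ha hb hC hx').tsum_eq_zero_add, ← tsum_div_const]
  congr 1
  · rw [periodTerm_offDiag a b f 0 hx']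
    simp only [weight, swap, bitZero_zero_left hx, if_true]
    norm_num
    ring
  · refine tsum_congr fun k => ?_
    rw [periodTerm_offDiag a b f _ hx', periodTerm_offDiag a b _ _ (left_mem hx), swap_succ_left]
    rw [weight_succ_left]
    ring

theorem period_right {a b : ℂ} (ha : ‖a‖ ≤ 1) (hb : ‖b‖ ≤ 1) {f : ℝ → ℂ} {C : ℝ}
    (hC : ∀ x, ‖f x‖ ≤ C) {x : ℝ} (hx : x ∈ Ioc (1 / 2 : ℝ) 1) :
    period (offDiag a b) f x = b * f (x - 1 / 2) / 2
      + period (offDiag a b) (fun y => f ((y + 1) / 2)) (2 * x - 1) / 2 := by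
  have hx' := right_subset hx
  unfold period
  rw [(summable_periodTerm ha hb hC hx').tsum_eq_zero_add, ← tsum_div_const]
  congr 1
  · rw [periodTerm_offDiag a b f 0 hx']
    simp only [weight, swap, bitZero_zero_right hx, if_false]
    norm_num
    ring
  · refine tsum_congr fun k => ?_
    rw [periodTerm_offDiag a b f _ hx', periodTerm_offDiag a b _ _ (right_mem hx),
      swap_succ_right]
    rw [weight_succ_right]
    ring

theorem integral_left (f : ℝ → ℂ) (u v : ℝ) :
    ∫ y in u..v, f y = (∫ y in (2 * u)..(2 * v), f (y / 2)) / 2 := by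
  rw [intervalIntegral.integral_comp_div _ two_ne_zero]
  simp

theorem integral_right (f : ℝ → ℂ) (u v : ℝ) :
    ∫ y in u..v, f y = (∫ y in (2 * u - 1)..(2 * v - 1), f ((y + 1) / 2)) / 2 := by
  rw [intervalIntegral.integral_comp_add_right (fun y => f (y / 2)),
    intervalIntegral.integral_comp_div _ two_ne_zero]
  simp

theorem integral_halves {f : ℝ → ℂ} (hf : IntegrableOn f (Ioc 0 1)) :
    ∫ y in (0 : ℝ)..1, f y =
      (∫ y in (0 : ℝ)..1, f (y / 2)) / 2 + (∫ y in (0 : ℝ)..1, f ((y + 1) / 2)) / 2 := by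
  have hh : (1 / 2 : ℝ) ∈ Icc (0 : ℝ) 1 := by constructor <;> norm_num
  rw [← intervalIntegral.integral_add_adjacent_intervals
    (intervalIntegrable_of_mem hf (by simp) hh) (intervalIntegrable_of_mem hf hh (by simp)),
    integral_left f 0, integral_right f (1 / 2)]
  norm_num

/-- The operator `a P₋ + b P₊` on functions. -/
noncomputable def haarOp (a b : ℂ) (f : ℝ → ℂ) (x : ℝ) : ℂ :=
  period (offDiag a b) f x + a * antideriv f x + b * antiderivTr f x

theorem haarOp_one_zero : haarOp 1 0 = Pminus := by
  funext f x
  simp [haarOp, Pminus, offDiag, sigmaMinus]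

theorem haarOp_zero_one : haarOp 0 1 = Pplus := by
  funext f x
  simp [haarOp, Pplus, offDiag, sigmaPlus]

theorem haarOp_congr (a b : ℂ) {f g : ℝ → ℂ} (h : EqOn f g (Ioc 0 1)) :
    EqOn (haarOp a b f) (haarOp a b g) (Ioc 0 1) := by
  intro x hx
  have h1 : period (offDiag a b) f x = period (offDiag a b) g x := by
    refine tsum_congr fun k => ?_
    rw [periodTerm_offDiag a b _ _ hx, periodTerm_offDiag a b _ _ hx, h (swap_mem hx)]
  have h2 : antideriv f x = antideriv g x :=
    intervalIntegral.integral_congr_ae (.of_forall fun y hy => h <| by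
      rw [uIoc_of_le hx.1.le] at hy
      exact ⟨hy.1, hy.2.trans hx.2⟩)
  have h3 : antiderivTr f x = antiderivTr g x :=
    intervalIntegral.integral_congr_ae (.of_forall fun y hy => h <| by
      rw [uIoc_of_le hx.2] at hy
      exact ⟨hx.1.trans hy.1, hy.2⟩)
  rw [haarOp, haarOp, h1, h2, h3]

theorem haarOp_const_mul (a b c : ℂ) (f : ℝ → ℂ) {x : ℝ} (hx : x ∈ Ioc (0 : ℝ) 1) :
    haarOp a b (fun y => c * f y) x = c * haarOp a b f x := by
  have h1 : period (offDiag a b) (fun y => c * f y) x = c * period (offDiag a b) f x := by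
    unfold period
    rw [← tsum_mul_left]
    refine tsum_congr fun k => ?_
    rw [periodTerm_offDiag a b _ _ hx, periodTerm_offDiag a b _ _ hx]
    ring
  have h2 : antideriv (fun y => c * f y) x = c * antideriv f x :=
    intervalIntegral.integral_const_mul c f
  have h3 : antiderivTr (fun y => c * f y) x = c * antiderivTr f x :=
    intervalIntegral.integral_const_mul c f
  rw [haarOp, haarOp, h1, h2, h3]
  ring

theorem integrableOn_of_bounded {f : ℝ → ℂ} {C : ℝ} (hf : Measurable f) (hC : ∀ x, ‖f x‖ ≤ C) :
    IntegrableOn f (Ioc 0 1) :=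
  Measure.integrableOn_of_bounded (by simp) hf.aestronglyMeasurable (.of_forall hC)

/-- From a point of the left half, `L` sees only that half, whereas `L'` also integrates over the
whole right half; this produces the term with `b`. -/
theorem haarOp_left {a b : ℂ} (ha : ‖a‖ ≤ 1) (hb : ‖b‖ ≤ 1) {f : ℝ → ℂ} {C : ℝ}
    (hf : Measurable f) (hC : ∀ x, ‖f x‖ ≤ C) {x : ℝ} (hx : x ∈ Ioc (0 : ℝ) (1 / 2)) :
    haarOp a b f x = (a * f (x + 1 / 2) + b * ∫ y in (0 : ℝ)..1, f ((y + 1) / 2)) / 2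
      + haarOp a b (fun y => f (y / 2)) (2 * x) / 2 := by
  have hI := integrableOn_of_bounded hf hC
  have hh : (1 / 2 : ℝ) ∈ Icc (0 : ℝ) 1 := by constructor <;> norm_num
  have h1 : antideriv f x = antideriv (fun y => f (y / 2)) (2 * x) / 2 := by
    unfold antideriv
    rw [integral_left f, mul_zero]
  have h2 : antiderivTr f x = antiderivTr (fun y => f (y / 2)) (2 * x) / 2
      + (∫ y in (0 : ℝ)..1, f ((y + 1) / 2)) / 2 := by
    unfold antiderivTr
    have hx' := Ioc_subset_Icc_self (left_subset hx)
    rw [← intervalIntegral.integral_add_adjacent_intervals (intervalIntegrable_of_mem hI hx' hh)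
      (intervalIntegrable_of_mem hI hh (by simp)), integral_left f x, integral_right f (1 / 2)]
    norm_num
  rw [haarOp, haarOp, h1, h2, period_left ha hb hC hx]
  ring

theorem haarOp_right {a b : ℂ} (ha : ‖a‖ ≤ 1) (hb : ‖b‖ ≤ 1) {f : ℝ → ℂ} {C : ℝ}
    (hf : Measurable f) (hC : ∀ x, ‖f x‖ ≤ C) {x : ℝ} (hx : x ∈ Ioc (1 / 2 : ℝ) 1) :
    haarOp a b f x = ((a * ∫ y in (0 : ℝ)..1, f (y / 2)) + b * f (x - 1 / 2)) / 2
      + haarOp a b (fun y => f ((y + 1) / 2)) (2 * x - 1) / 2 := by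
  have hI := integrableOn_of_bounded hf hC
  have hh : (1 / 2 : ℝ) ∈ Icc (0 : ℝ) 1 := by constructor <;> norm_num
  have h1 : antiderivTr f x = antiderivTr (fun y => f ((y + 1) / 2)) (2 * x - 1) / 2 := by
    unfold antiderivTr
    rw [integral_right f]
    norm_num
  have h2 : antideriv f x = (∫ y in (0 : ℝ)..1, f (y / 2)) / 2
      + antideriv (fun y => f ((y + 1) / 2)) (2 * x - 1) / 2 := by
    unfold antideriv
    have hx' := Ioc_subset_Icc_self (right_subset hx)
    rw [← intervalIntegral.integral_add_adjacent_intervals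
      (intervalIntegrable_of_mem hI (by simp) hh) (intervalIntegrable_of_mem hI hh hx'),
      integral_left f 0, integral_right f (1 / 2)]
    norm_num
  rw [haarOp, haarOp, h1, h2, period_right ha hb hC hx]
  ring

theorem mem_left_or_right {x : ℝ} (hx : x ∈ Ioc (0 : ℝ) 1) :
    x ∈ Ioc (0 : ℝ) (1 / 2) ∨ x ∈ Ioc (1 / 2 : ℝ) 1 := by
  rcases le_or_gt x (1 / 2) with h | h
  · exact .inl ⟨hx.1, h⟩
  · exact .inr ⟨h, hx.2⟩

/-- By self-similarity the deviation from `1` at a point is half the deviation at another point of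
`(0,1]`. Being bounded, it vanishes. The initial bound `4` counts `1` for the series, for each
integral and for the subtracted constant. -/
theorem haarOp_const_one {a b : ℂ} (ha : ‖a‖ ≤ 1) (hb : ‖b‖ ≤ 1) (hab : a + b = 1) {x : ℝ}
    (hx : x ∈ Ioc (0 : ℝ) 1) : haarOp a b (fun _ => 1) x = 1 := by
  have h1 : ∀ x : ℝ, ‖(fun _ => 1 : ℝ → ℂ) x‖ ≤ 1 := by simp
  have key : ∀ n : ℕ, ∀ x ∈ Ioc (0 : ℝ) 1, ‖haarOp a b (fun _ => 1) x - 1‖ ≤ 4 * (1 / 2) ^ n := by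
    intro n
    induction n with
    | zero =>
      intro x hx
      have h2 := norm_period_le ha hb h1 hx
      have h3 : ‖antideriv (fun _ => 1) x‖ ≤ 1 := by
        simp only [antideriv, intervalIntegral.integral_const, sub_zero, norm_smul, norm_one,
          mul_one, Real.norm_eq_abs]
        rw [abs_le]; constructor <;> linarith [hx.1, hx.2]
      have h4 : ‖antiderivTr (fun _ => 1) x‖ ≤ 1 := by
        simp only [antiderivTr, intervalIntegral.integral_const, norm_smul, norm_one,
          mul_one, Real.norm_eq_abs]
        rw [abs_le]; constructor <;> linarith [hx.1, hx.2]
      have h5 : ‖a * antideriv (fun _ => 1) x‖ ≤ 1 := by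
        rw [norm_mul]; exact mul_le_one₀ ha (norm_nonneg _) h3
      have h6 : ‖b * antiderivTr (fun _ => 1) x‖ ≤ 1 := by
        rw [norm_mul]; exact mul_le_one₀ hb (norm_nonneg _) h4
      have h7 := norm_sub_le (haarOp a b (fun _ => 1) x) 1
      have h8 := norm_add₃_le (a := period (offDiag a b) (fun _ => 1) x)
        (b := a * antideriv (fun _ => 1) x) (c := b * antiderivTr (fun _ => 1) x)
      rw [norm_one] at h7
      rw [pow_zero]
      unfold haarOp at h7 ⊢
      linarith
    | succ n ih =>
      intro x hx
      have hrec : ∃ y ∈ Ioc (0 : ℝ) 1,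
          haarOp a b (fun _ => 1) x - 1 = (haarOp a b (fun _ => 1) y - 1) / 2 := by
        rcases mem_left_or_right hx with h | h
        · refine ⟨2 * x, left_mem h, ?_⟩
          rw [haarOp_left ha hb measurable_const h1 h]
          simp
          linear_combination (1 / 2) * hab
        · refine ⟨2 * x - 1, right_mem h, ?_⟩
          rw [haarOp_right ha hb measurable_const h1 h]
          simp
          linear_combination (1 / 2) * hab
      obtain ⟨y, hy, hxy⟩ := hrec
      rw [hxy, norm_div, Complex.norm_ofNat, pow_succ]
      linarith [ih y hy]
  have hlim : Filter.Tendsto (fun n : ℕ => 4 * (1 / 2 : ℝ) ^ n) Filter.atTop (nhds 0) := by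
    simpa using (tendsto_pow_atTop_nhds_zero_of_lt_one (r := (1 / 2 : ℝ)) (by norm_num)
      (by norm_num)).const_mul 4
  have := ge_of_tendsto' hlim fun n => key n x hx
  exact sub_eq_zero.mp (norm_le_zero_iff.mp this)

/-! ### Self-similarity of the Haar functions -/

theorem H_eq (x : ℝ) : H x = G (2 * x) - G (2 * x - 1) := by
  have h : ((Real.sqrt 2 : ℝ) : ℂ) ≠ 0 := by
    rw [Complex.ofReal_ne_zero]; positivity
  unfold H Gfun
  field_simp
  simp

theorem G_of_mem {x : ℝ} (hx : x ∈ Ioc (0 : ℝ) 1) : G x = 1 := indicator_of_mem hx _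

theorem G_of_notMem {x : ℝ} (hx : x ∉ Ioc (0 : ℝ) 1) : G x = 0 := indicator_of_notMem hx _

theorem H_of_nonpos {x : ℝ} (hx : x ≤ 0) : H x = 0 := by
  rw [H_eq, G_of_notMem, G_of_notMem, sub_zero] <;> rintro ⟨h1, h2⟩ <;> linarith

theorem H_of_one_lt {x : ℝ} (hx : 1 < x) : H x = 0 := by
  rw [H_eq, G_of_notMem, G_of_notMem, sub_zero] <;> rintro ⟨h1, h2⟩ <;> linarith

theorem H_left {x : ℝ} (hx : x ∈ Ioc (0 : ℝ) 1) : H (x / 2) = 1 := by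
  rw [H_eq, G_of_mem, G_of_notMem, sub_zero]
  · rintro ⟨h1, h2⟩; linarith [hx.2]
  · rwa [mul_div_cancel₀ _ two_ne_zero]

theorem H_right {x : ℝ} (hx : x ∈ Ioc (0 : ℝ) 1) : H ((x + 1) / 2) = -1 := by
  rw [H_eq, mul_div_cancel₀ _ two_ne_zero, add_sub_cancel_right, G_of_mem hx, G_of_notMem,
    zero_sub]
  rintro ⟨h1, h2⟩; linarith [hx.1]

theorem Gfun_zero_zero : Gfun 0 0 = G := by
  funext x; simp [Gfun]

theorem Hfun_zero_zero : Hfun 0 0 = H := by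
  funext x; simp [Hfun]

theorem val_halves_inl {n : ℕ} (k : Fin (2 ^ n)) : (halves n (.inl k) : ℕ) = k := by
  simp [halves]

theorem val_halves_inr {n : ℕ} (k : Fin (2 ^ n)) : (halves n (.inr k) : ℕ) = 2 ^ n + k := by
  simp [halves, add_comm]

theorem Hfun_inl_left {n : ℕ} (k : Fin (2 ^ n)) (x : ℝ) :
    Hfun (n + 1) (halves n (.inl k)) (x / 2) = ((Real.sqrt 2 : ℝ) : ℂ) * Hfun n k x := by
  have h : (2 : ℝ) ^ (n + 1) * (x / 2) - k = 2 ^ n * x - k := by ring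
  rw [val_halves_inl, Hfun, Hfun, h, pow_succ']
  push_cast; ring

theorem Hfun_inr_right {n : ℕ} (k : Fin (2 ^ n)) (x : ℝ) :
    Hfun (n + 1) (halves n (.inr k)) ((x + 1) / 2) = ((Real.sqrt 2 : ℝ) : ℂ) * Hfun n k x := by
  have h : (2 : ℝ) ^ (n + 1) * ((x + 1) / 2) - ((2 ^ n + k : ℕ) : ℝ) = 2 ^ n * x - k := by
    push_cast; ring
  rw [val_halves_inr, Hfun, Hfun, h, pow_succ']
  push_cast; ring

theorem Hfun_inl_right {n : ℕ} (k : Fin (2 ^ n)) {x : ℝ} (hx : x ∈ Ioc (0 : ℝ) 1) :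
    Hfun (n + 1) (halves n (.inl k)) ((x + 1) / 2) = 0 := by
  rw [val_halves_inl, Hfun, H_of_one_lt, mul_zero]
  have h1 : (k : ℝ) + 1 ≤ 2 ^ n := by exact_mod_cast k.isLt
  have h2 : (0 : ℝ) < 2 ^ n * x := mul_pos (by positivity) hx.1
  rw [pow_succ]
  linarith

theorem Hfun_inr_left {n : ℕ} (k : Fin (2 ^ n)) {x : ℝ} (hx : x ∈ Ioc (0 : ℝ) 1) :
    Hfun (n + 1) (halves n (.inr k)) (x / 2) = 0 := by
  rw [val_halves_inr, Hfun, H_of_nonpos, mul_zero]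
  have h2 : (2 : ℝ) ^ n * x ≤ 2 ^ n := mul_le_of_le_one_right (by positivity) hx.2
  have h3 : (0 : ℝ) ≤ k := by positivity
  push_cast
  rw [pow_succ]
  linarith

/-! ### Means and orthogonality relations of the Haar functions -/

theorem integral_congr_Ioc {f g : ℝ → ℂ} (h : ∀ x ∈ Ioc (0 : ℝ) 1, f x = g x) :
    ∫ x in (0 : ℝ)..1, f x = ∫ x in (0 : ℝ)..1, g x :=
  intervalIntegral.integral_congr_ae (.of_forall fun y hy => h y <| by
    rwa [uIoc_of_le zero_le_one] at hy)

theorem integral_halves_congr {f f₀ f₁ : ℝ → ℂ} (hf : IntegrableOn f (Ioc 0 1))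
    (h₀ : ∀ x ∈ Ioc (0 : ℝ) 1, f (x / 2) = f₀ x)
    (h₁ : ∀ x ∈ Ioc (0 : ℝ) 1, f ((x + 1) / 2) = f₁ x) :
    ∫ y in (0 : ℝ)..1, f y = (∫ y in (0 : ℝ)..1, f₀ y) / 2 + (∫ y in (0 : ℝ)..1, f₁ y) / 2 := by
  rw [integral_halves hf, integral_congr_Ioc h₀, integral_congr_Ioc h₁]

theorem integrableOn_Hfun (n k : ℕ) : IntegrableOn (Hfun n k) (Ioc 0 1) :=
  integrableOn_of_bounded (measurable_Hfun n k) (norm_Hfun_le n k)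

theorem integrableOn_Hfun_mul_Hfun (n k m l : ℕ) :
    IntegrableOn (fun x => Hfun n k x * Hfun m l x) (Ioc 0 1) :=
  integrableOn_of_bounded ((measurable_Hfun n k).mul (measurable_Hfun m l)) fun x => by
    rw [norm_mul]
    exact mul_le_mul (norm_Hfun_le n k x) (norm_Hfun_le m l x) (norm_nonneg _) (by positivity)

theorem integral_Hfun (n : ℕ) (k : Fin (2 ^ n)) : ∫ x in (0 : ℝ)..1, Hfun n k x = 0 := by
  have hI := integrableOn_Hfun n k
  induction n with
  | zero =>
    have hk : (k : ℕ) = 0 := by have := k.isLt; simp at this ⊢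
    rw [hk, Hfun_zero_zero] at hI ⊢
    rw [integral_halves_congr hI (fun x hx => H_left hx) (fun x hx => H_right hx)]
    norm_num
  | succ n ih =>
    obtain ⟨i | i, rfl⟩ := (halves n).surjective k
    · rw [integral_halves_congr hI (fun x _ => Hfun_inl_left i x)
        (fun x hx => Hfun_inl_right i hx), intervalIntegral.integral_const_mul,
        ih i (integrableOn_Hfun n i)]
      simp
    · rw [integral_halves_congr hI (fun x hx => Hfun_inr_left i hx)
        (fun x _ => Hfun_inr_right i x), intervalIntegral.integral_const_mul,
        ih i (integrableOn_Hfun n i)]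
      simp

theorem sqrt_two_mul_self : ((Real.sqrt 2 : ℝ) : ℂ) * ((Real.sqrt 2 : ℝ) : ℂ) = 2 := by
  rw [← Complex.ofReal_mul, Real.mul_self_sqrt (by norm_num)]; norm_num

theorem integral_Hfun_mul_Hfun_zero (n : ℕ) (k : Fin (2 ^ (n + 1))) :
    ∫ x in (0 : ℝ)..1, Hfun (n + 1) k x * Hfun 0 0 x = 0 := by
  have hI := integrableOn_Hfun_mul_Hfun (n + 1) k 0 0
  rw [Hfun_zero_zero] at hI ⊢
  obtain ⟨i | i, rfl⟩ := (halves n).surjective k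
  · rw [integral_halves_congr hI (f₀ := fun x => ((Real.sqrt 2 : ℝ) : ℂ) * Hfun n i x)
      (f₁ := fun _ => 0) (fun x hx => by rw [Hfun_inl_left, H_left hx, mul_one])
      (fun x hx => by rw [Hfun_inl_right i hx, zero_mul]),
      intervalIntegral.integral_const_mul, integral_Hfun n i]
    simp
  · rw [integral_halves_congr hI (f₁ := fun x => -((Real.sqrt 2 : ℝ) : ℂ) * Hfun n i x)
      (f₀ := fun _ => 0) (fun x hx => by rw [Hfun_inr_left i hx, zero_mul])
      (fun x hx => by rw [Hfun_inr_right, H_right hx]; ring),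
      intervalIntegral.integral_const_mul, integral_Hfun n i]
    simp

/-- The two factors `√2` from the normalization cancel the `1/2` from the change of variables. -/
theorem integral_Hfun_mul_Hfun_inl (n m : ℕ) (i : Fin (2 ^ n)) (j : Fin (2 ^ m)) :
    ∫ x in (0 : ℝ)..1, Hfun (n + 1) (halves n (.inl i)) x * Hfun (m + 1) (halves m (.inl j)) x
      = ∫ x in (0 : ℝ)..1, Hfun n i x * Hfun m j x := by
  rw [integral_halves_congr (integrableOn_Hfun_mul_Hfun _ _ _ _)
    (f₀ := fun x => 2 * (Hfun n i x * Hfun m j x)) (f₁ := fun _ => 0)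
    (fun x _ => by rw [Hfun_inl_left, Hfun_inl_left, ← sqrt_two_mul_self]; ring)
    (fun x hx => by rw [Hfun_inl_right i hx, zero_mul]), intervalIntegral.integral_const_mul]
  simp

theorem integral_Hfun_mul_Hfun_inr (n m : ℕ) (i : Fin (2 ^ n)) (j : Fin (2 ^ m)) :
    ∫ x in (0 : ℝ)..1, Hfun (n + 1) (halves n (.inr i)) x * Hfun (m + 1) (halves m (.inr j)) x
      = ∫ x in (0 : ℝ)..1, Hfun n i x * Hfun m j x := by
  rw [integral_halves_congr (integrableOn_Hfun_mul_Hfun _ _ _ _)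
    (f₀ := fun _ => 0) (f₁ := fun x => 2 * (Hfun n i x * Hfun m j x))
    (fun x hx => by rw [Hfun_inr_left i hx, zero_mul])
    (fun x _ => by rw [Hfun_inr_right, Hfun_inr_right, ← sqrt_two_mul_self]; ring),
    intervalIntegral.integral_const_mul]
  simp

theorem integral_Hfun_mul_Hfun_inl_inr (n m : ℕ) (i : Fin (2 ^ n)) (j : Fin (2 ^ m)) :
    ∫ x in (0 : ℝ)..1, Hfun (n + 1) (halves n (.inl i)) x * Hfun (m + 1) (halves m (.inr j)) x
      = 0 := by
  rw [integral_halves_congr (integrableOn_Hfun_mul_Hfun _ _ _ _)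
    (f₀ := fun _ => 0) (f₁ := fun _ => 0)
    (fun x hx => by rw [Hfun_inr_left j hx, mul_zero])
    (fun x hx => by rw [Hfun_inl_right i hx, zero_mul])]
  simp

theorem integral_Hfun_mul_self (n : ℕ) (k : Fin (2 ^ n)) :
    ∫ x in (0 : ℝ)..1, Hfun n k x * Hfun n k x = 1 := by
  induction n with
  | zero =>
    have hk : (k : ℕ) = 0 := by have := k.isLt; simp at this ⊢
    have hI := integrableOn_Hfun_mul_Hfun 0 0 0 0
    rw [hk, Hfun_zero_zero]
    rw [Hfun_zero_zero] at hI
    rw [integral_halves_congr hI (f₀ := fun _ => 1) (f₁ := fun _ => 1)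
      (fun x hx => by rw [H_left hx, mul_one])
      (fun x hx => by rw [H_right hx, mul_neg_one, neg_neg])]
    norm_num
  | succ n ih =>
    obtain ⟨i | i, rfl⟩ := (halves n).surjective k
    · rw [integral_Hfun_mul_Hfun_inl, ih]
    · rw [integral_Hfun_mul_Hfun_inr, ih]

/-- Both levels are lowered together: functions on different halves have disjoint supports, and
those on the same half rescale to the previous levels. When one level reaches `0`, that function is
constant on each half and the other has mean zero. -/
theorem integral_Hfun_mul_Hfun_of_ne (n m : ℕ) (k : Fin (2 ^ n)) (l : Fin (2 ^ m))
    (h : (⟨n, k⟩ : Σ n : ℕ, Fin (2 ^ n)) ≠ ⟨m, l⟩) :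
    ∫ x in (0 : ℝ)..1, Hfun n k x * Hfun m l x = 0 := by
  have h0 : ∀ k : Fin (2 ^ 0), k = 0 := fun k => Fin.ext (by have := k.isLt; simp at this ⊢)
  induction n generalizing m with
  | zero =>
    obtain rfl := h0 k
    cases m with
    | zero => exact absurd (by rw [h0 l]) h
    | succ m =>
      simp_rw [mul_comm (Hfun 0 _ _)]
      exact integral_Hfun_mul_Hfun_zero m l
  | succ n ih =>
    cases m with
    | zero =>
      obtain rfl := h0 l
      exact integral_Hfun_mul_Hfun_zero n k
    | succ m =>
      obtain ⟨i | i, rfl⟩ := (halves n).surjective k <;>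
        obtain ⟨j | j, rfl⟩ := (halves m).surjective l
      · rw [integral_Hfun_mul_Hfun_inl]
        refine ih _ _ _ fun hij => h ?_
        cases hij; rfl
      · exact integral_Hfun_mul_Hfun_inl_inr n m i j
      · simp_rw [mul_comm (Hfun (n + 1) _ _)]
        exact integral_Hfun_mul_Hfun_inl_inr m n j i
      · rw [integral_Hfun_mul_Hfun_inr]
        refine ih _ _ _ fun hij => h ?_
        cases hij; rfl

/-! ### The action on the Haar functions -/

/-- The blocks of `a P₋ + b P₊`. -/
noncomputable def blockMatrix (a b : ℂ) : ∀ n : ℕ, Matrix (Fin (2 ^ n)) (Fin (2 ^ n)) ℂ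
  | 0 => 0
  | n + 1 => (1 / 2 : ℂ) • Matrix.reindex (halves n) (halves n)
      (Matrix.fromBlocks (blockMatrix a b n) (a • 1) (b • 1) (blockMatrix a b n))

theorem haarOp_half {a b : ℂ} (ha : ‖a‖ ≤ 1) (hb : ‖b‖ ≤ 1) {f : ℝ → ℂ} {C : ℝ}
    (hf : Measurable f) (hC : ∀ x, ‖f x‖ ≤ C) {x : ℝ} (hx : x ∈ Ioc (0 : ℝ) 1) :
    haarOp a b f (x / 2) = (a * f ((x + 1) / 2) + b * ∫ y in (0 : ℝ)..1, f ((y + 1) / 2)) / 2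
      + haarOp a b (fun y => f (y / 2)) x / 2 := by
  rw [haarOp_left ha hb hf hC ⟨by linarith [hx.1], by linarith [hx.2]⟩, add_div x,
    mul_div_cancel₀ _ two_ne_zero]

theorem haarOp_add_one_half {a b : ℂ} (ha : ‖a‖ ≤ 1) (hb : ‖b‖ ≤ 1) {f : ℝ → ℂ} {C : ℝ}
    (hf : Measurable f) (hC : ∀ x, ‖f x‖ ≤ C) {x : ℝ} (hx : x ∈ Ioc (0 : ℝ) 1) :
    haarOp a b f ((x + 1) / 2) = ((a * ∫ y in (0 : ℝ)..1, f (y / 2)) + b * f (x / 2)) / 2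
      + haarOp a b (fun y => f ((y + 1) / 2)) x / 2 := by
  rw [haarOp_right ha hb hf hC ⟨by linarith [hx.1], by linarith [hx.2]⟩, ← sub_div,
    mul_div_cancel₀ _ two_ne_zero, add_sub_cancel_right]

theorem exists_eq_half {x : ℝ} (hx : x ∈ Ioc (0 : ℝ) 1) :
    ∃ y ∈ Ioc (0 : ℝ) 1, x = y / 2 ∨ x = (y + 1) / 2 := by
  rcases mem_left_or_right hx with h | h
  · exact ⟨_, left_mem h, .inl (by ring)⟩
  · exact ⟨_, right_mem h, .inr (by ring)⟩

/-- The halves of `H` are the constants `1` and `-1`. On each half the exchange and integral terms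
add up to `∓(a + b)/2`, cancelling the `±1/2` from the fixed constant. -/
theorem haarOp_H {a b : ℂ} (ha : ‖a‖ ≤ 1) (hb : ‖b‖ ≤ 1) (hab : a + b = 1) {x : ℝ}
    (hx : x ∈ Ioc (0 : ℝ) 1) : haarOp a b H x = 0 := by
  have hm : ∀ x ∈ Ioc (0 : ℝ) 1, haarOp a b (fun _ => -1) x = -1 := fun x hx => by
    have := haarOp_const_mul a b (-1) (fun _ => 1) hx
    rw [haarOp_const_one ha hb hab hx] at this
    simpa using this
  obtain ⟨y, hy, rfl | rfl⟩ := exists_eq_half hx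
  · rw [haarOp_half ha hb measurable_H norm_H_le hy, H_right hy,
      integral_congr_Ioc fun z hz => H_right hz,
      haarOp_congr a b (g := fun _ => 1) (fun z hz => H_left hz) hy,
      haarOp_const_one ha hb hab hy]
    simp
    linear_combination (-1 / 2) * hab
  · rw [haarOp_add_one_half ha hb measurable_H norm_H_le hy, H_left hy,
      integral_congr_Ioc fun z hz => H_left hz,
      haarOp_congr a b (g := fun _ => -1) (fun z hz => H_right hz) hy, hm y hy]
    simp
    linear_combination (1 / 2) * hab

theorem haarOp_zero (a b : ℂ) {x : ℝ} (hx : x ∈ Ioc (0 : ℝ) 1) :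
    haarOp a b (fun _ => 0) x = 0 := by
  simpa using haarOp_const_mul a b 0 (fun _ => 0) hx

/-- On the half that supports the function, the rescaled operator yields the diagonal block. On the
other half only the exchanged copy remains, with coefficient `a` or `b`, because the mean vanishes.
-/
theorem haarOp_Hfun {a b : ℂ} (ha : ‖a‖ ≤ 1) (hb : ‖b‖ ≤ 1) (hab : a + b = 1) (n : ℕ)
    (k : Fin (2 ^ n)) {x : ℝ} (hx : x ∈ Ioc (0 : ℝ) 1) :
    haarOp a b (Hfun n k) x = ∑ j, blockMatrix a b n j k * Hfun n j x := by
  induction n generalizing x with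
  | zero =>
    have hk : (k : ℕ) = 0 := by have := k.isLt; simp at this ⊢
    rw [hk, Hfun_zero_zero, haarOp_H ha hb hab hx]
    simp [blockMatrix]
  | succ n ih =>
    have hrec : ∀ k x, x ∈ Ioc (0 : ℝ) 1 →
        haarOp a b (fun y => ((Real.sqrt 2 : ℝ) : ℂ) * Hfun n (k : Fin (2 ^ n)) y) x =
          ((Real.sqrt 2 : ℝ) : ℂ) * ∑ j, blockMatrix a b n j k * Hfun n j x := fun k x hx => by
      rw [haarOp_const_mul a b _ _ hx, ih k hx]
    rw [← (halves n).sum_comp, Fintype.sum_sum_type]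
    obtain ⟨i | i, rfl⟩ := (halves n).surjective k
    · obtain ⟨y, hy, rfl | rfl⟩ := exists_eq_half hx
      · rw [haarOp_half ha hb (measurable_Hfun _ _) (norm_Hfun_le _ _) hy, Hfun_inl_right i hy,
          integral_congr_Ioc fun z hz => Hfun_inl_right i hz,
          haarOp_congr a b (fun z _ => Hfun_inl_left i z) hy, hrec i y hy]
        simp only [Hfun_inl_left, Hfun_inr_left _ hy, blockMatrix]
        simp [Finset.mul_sum, Finset.sum_div]
        exact Finset.sum_congr rfl fun j _ => by ring
      · rw [haarOp_add_one_half ha hb (measurable_Hfun _ _) (norm_Hfun_le _ _) hy,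
          Hfun_inl_left i y, integral_congr_Ioc fun z _ => Hfun_inl_left i z,
          haarOp_congr a b (fun z hz => Hfun_inl_right i hz) hy, haarOp_zero a b hy,
          intervalIntegral.integral_const_mul, integral_Hfun]
        simp only [Hfun_inr_right, Hfun_inl_right _ hy, blockMatrix]
        simp [Matrix.one_apply]
        ring
    · obtain ⟨y, hy, rfl | rfl⟩ := exists_eq_half hx
      · rw [haarOp_half ha hb (measurable_Hfun _ _) (norm_Hfun_le _ _) hy, Hfun_inr_right i y,
          integral_congr_Ioc fun z _ => Hfun_inr_right i z,
          haarOp_congr a b (fun z hz => Hfun_inr_left i hz) hy, haarOp_zero a b hy,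
          intervalIntegral.integral_const_mul, integral_Hfun]
        simp only [Hfun_inl_left, Hfun_inr_left _ hy, blockMatrix]
        simp [Matrix.one_apply]
        ring
      · rw [haarOp_add_one_half ha hb (measurable_Hfun _ _) (norm_Hfun_le _ _) hy,
          Hfun_inr_left i hy, integral_congr_Ioc fun z hz => Hfun_inr_left i hz,
          haarOp_congr a b (fun z _ => Hfun_inr_right i z) hy, hrec i y hy]
        simp only [Hfun_inr_right, Hfun_inl_right _ hy, blockMatrix]
        simp [Finset.mul_sum, Finset.sum_div]
        exact Finset.sum_congr rfl fun j _ => by ring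

/-! ### The Haar basis -/

/-- The Haar functions as elements of `L₂(0,1]`. -/
noncomputable def haarVec : HaarIndex → L2
  | none => gVec 0 0
  | some ⟨n, k⟩ => hVec n k

theorem coeFn_haarVec (i : HaarIndex) : (haarVec i : ℝ → ℂ) =ᵐ[mu] haarFun i := by
  match i with
  | none => exact (memLp_Gfun 0 0).coeFn_toLp
  | some ⟨n, k⟩ => exact (memLp_Hfun n k).coeFn_toLp

theorem conj_G (x : ℝ) : (starRingEnd ℂ) (G x) = G x := by
  by_cases h : x ∈ Ioc (0 : ℝ) 1
  · rw [G_of_mem h, map_one]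
  · rw [G_of_notMem h, map_zero]

theorem conj_haarFun (i : HaarIndex) (x : ℝ) : (starRingEnd ℂ) (haarFun i x) = haarFun i x := by
  match i with
  | none => simp [haarFun, Gfun, conj_G]
  | some ⟨n, k⟩ => simp [haarFun, Hfun, H_eq, conj_G]

theorem inner_haarVec (i : HaarIndex) (f : L2) :
    inner ℂ (haarVec i) f = ∫ x in Ioc (0 : ℝ) 1, f x * haarFun i x := by
  rw [L2.inner_def]
  refine integral_congr_ae ?_
  filter_upwards [coeFn_haarVec i] with x hx
  rw [RCLike.inner_apply, hx, conj_haarFun]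

theorem inner_haarVec_haarVec (i j : HaarIndex) :
    inner ℂ (haarVec i) (haarVec j) = ∫ x in (0 : ℝ)..1, haarFun j x * haarFun i x := by
  rw [inner_haarVec, intervalIntegral.integral_of_le zero_le_one]
  refine integral_congr_ae ?_
  filter_upwards [coeFn_haarVec j] with x hx
  rw [hx]

theorem inner_haarVec_self (i : HaarIndex) : inner ℂ (haarVec i) (haarVec i) = 1 := by
  rw [inner_haarVec_haarVec]
  match i with
  | none =>
    rw [integral_congr_Ioc (g := fun _ => 1)
      fun x hx => by rw [haarFun, Gfun_zero_zero, G_of_mem hx, mul_one]]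
    simp
  | some ⟨n, k⟩ => exact integral_Hfun_mul_self n k

theorem inner_haarVec_of_ne {i j : HaarIndex} (h : i ≠ j) :
    inner ℂ (haarVec i) (haarVec j) = 0 := by
  rw [inner_haarVec_haarVec]
  match i, j with
  | none, none => exact absurd rfl h
  | none, some ⟨n, k⟩ =>
    rw [integral_congr_Ioc fun x hx => by rw [haarFun.eq_1, Gfun_zero_zero, G_of_mem hx, mul_one]]
    exact integral_Hfun n k
  | some ⟨n, k⟩, none =>
    rw [integral_congr_Ioc fun x hx => by rw [haarFun.eq_1, Gfun_zero_zero, G_of_mem hx, one_mul]]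
    exact integral_Hfun n k
  | some ⟨n, k⟩, some ⟨m, l⟩ =>
    exact integral_Hfun_mul_Hfun_of_ne m n l k fun h' => h (by rw [h'])

theorem orthonormal_haarVec : Orthonormal ℂ haarVec := by
  refine ⟨fun i => ?_, fun i j h => inner_haarVec_of_ne h⟩
  rw [@norm_eq_sqrt_re_inner ℂ, inner_haarVec_self]
  simp

/-! ### Completeness of the Haar system -/

theorem Hfun_eq_indicator (n k : ℕ) (x : ℝ) :
    Hfun n k x = ((Real.sqrt 2 ^ n : ℝ) : ℂ) *
      ((dyadic (n + 1) (2 * k)).indicator 1 x - (dyadic (n + 1) (2 * k + 1)).indicator 1 x) := by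
  have hp : (0 : ℝ) < 2 ^ (n + 1) := by positivity
  have key : ∀ m : ℕ, G (2 ^ (n + 1) * x - m) = (dyadic (n + 1) m).indicator 1 x := by
    intro m
    have : 2 ^ (n + 1) * x - m ∈ Ioc (0 : ℝ) 1 ↔ x ∈ dyadic (n + 1) m := by
      rw [dyadic, mem_Ioc, mem_Ioc, div_lt_iff₀ hp, le_div_iff₀ hp]
      constructor <;> rintro ⟨h1, h2⟩ <;> constructor <;> linarith
    by_cases h : x ∈ dyadic (n + 1) m
    · rw [G_of_mem (this.mpr h), indicator_of_mem h, Pi.one_apply]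
    · rw [G_of_notMem (mt this.mp h), indicator_of_notMem h]
  rw [Hfun, H_eq, ← key, ← key]
  push_cast
  ring_nf

theorem integral_mul_Hfun {f : ℝ → ℂ} (hf : IntegrableOn f (Ioc 0 1)) (n : ℕ) {k : ℕ}
    (hk : k < 2 ^ n) :
    ∫ x in Ioc (0 : ℝ) 1, f x * Hfun n k x = ((Real.sqrt 2 ^ n : ℝ) : ℂ) *
      ((∫ x in dyadic (n + 1) (2 * k), f x) - ∫ x in dyadic (n + 1) (2 * k + 1), f x) := by
  have hsub : ∀ m : ℕ, m < 2 ^ (n + 1) → dyadic (n + 1) m ⊆ Ioc (0 : ℝ) 1 := by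
    intro m hm
    refine Ioc_subset_Ioc (by positivity) ?_
    rw [div_le_one (by positivity)]
    exact_mod_cast hm
  have hm : ∀ m, MeasurableSet (dyadic (n + 1) m) := fun m => measurableSet_Ioc
  have hfun : (fun x => f x * Hfun n k x) = fun x => ((Real.sqrt 2 ^ n : ℝ) : ℂ) *
      ((dyadic (n + 1) (2 * k)).indicator f x - (dyadic (n + 1) (2 * k + 1)).indicator f x) := by
    funext x
    rw [Hfun_eq_indicator]
    simp only [indicator]
    split_ifs <;> simp <;> ring
  rw [hfun, integral_const_mul, integral_sub (hf.integrable.indicator (hm _))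
    (hf.integrable.indicator (hm _)), setIntegral_indicator (hm _),
    setIntegral_indicator (hm _), inter_eq_self_of_subset_right (hsub _ (by rw [pow_succ]; omega)),
    inter_eq_self_of_subset_right (hsub _ (by rw [pow_succ]; omega))]

/-- At a new midpoint, the vanishing Haar coefficient says that the primitive has equal increments
over the two halves. It is zero at both endpoints by induction, hence also at the midpoint. -/
theorem primitive_dyadic_eq_zero {f : ℝ → ℂ} (hf : IntegrableOn f (Ioc 0 1))
    (h0 : ∀ i, ∫ x in Ioc (0 : ℝ) 1, f x * haarFun i x = 0) (n : ℕ) {k : ℕ} (hk : k ≤ 2 ^ n) :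
    ∫ x in (0 : ℝ)..(k / 2 ^ n), f x = 0 := by
  induction n generalizing k with
  | zero =>
    have h1 : ∫ x in (0 : ℝ)..1, f x = 0 := by
      rw [← h0 none, intervalIntegral.integral_of_le zero_le_one]
      refine setIntegral_congr_fun measurableSet_Ioc fun x hx => ?_
      simp only [haarFun, Gfun_zero_zero, G_of_mem hx, mul_one]
    rw [pow_zero] at hk
    interval_cases k
    · simp
    · simpa using h1
  | succ n ih =>
    rw [pow_succ] at hk
    rcases Nat.even_or_odd' k with ⟨j, rfl | rfl⟩
    · have hj : ((2 * j : ℕ) : ℝ) / 2 ^ (n + 1) = j / 2 ^ n := by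
        push_cast; rw [pow_succ]; field_simp
      rw [hj]
      exact ih (by omega)
    · have hjn : j < 2 ^ n := by omega
      have hfint : ∀ {m : ℕ}, m ≤ 2 ^ (n + 1) →
          IntervalIntegrable f volume 0 ((m : ℝ) / 2 ^ (n + 1)) := fun hm =>
        intervalIntegrable_of_mem hf (by simp) ⟨by positivity, by
          rw [div_le_one (by positivity)]; exact_mod_cast hm⟩
      have hdy : ∀ {m : ℕ}, m + 1 ≤ 2 ^ (n + 1) → ∫ x in dyadic (n + 1) m, f x =
          (∫ x in (0 : ℝ)..(((m + 1 : ℕ) : ℝ) / 2 ^ (n + 1)), f x)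
            - ∫ x in (0 : ℝ)..((m : ℝ) / 2 ^ (n + 1)), f x := fun {m} hm => by
        rw [intervalIntegral.integral_interval_sub_left (hfint hm) (hfint (by omega)),
          intervalIntegral.integral_of_le (by push_cast; gcongr; linarith), dyadic]
        push_cast
        rfl
      have hcoef := h0 (some ⟨n, ⟨j, hjn⟩⟩)
      have hs : ((Real.sqrt 2 ^ n : ℝ) : ℂ) ≠ 0 := by
        rw [Complex.ofReal_ne_zero]; positivity
      have e1 : ((2 * j : ℕ) : ℝ) / 2 ^ (n + 1) = j / 2 ^ n := by
        push_cast; rw [pow_succ]; field_simp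
      have e2 : ((2 * j + 1 + 1 : ℕ) : ℝ) / 2 ^ (n + 1) = (j + 1 : ℕ) / 2 ^ n := by
        push_cast; rw [pow_succ]; field_simp; ring
      simp only [haarFun] at hcoef
      rw [integral_mul_Hfun hf n hjn, hdy (by rw [pow_succ]; omega),
        hdy (by rw [pow_succ]; omega), e1, e2, ih (by omega), ih (by omega), mul_eq_zero] at hcoef
      have := hcoef.resolve_left hs
      linear_combination (1 / 2) * this

/-- The primitive is continuous and vanishes at the dyadic points, so it vanishes on `[0,1]`;
Lebesgue differentiation recovers `f`. -/
theorem ae_eq_zero_of_haar {f : ℝ → ℂ} (hf : IntegrableOn f (Ioc 0 1))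
    (h0 : ∀ i, ∫ x in Ioc (0 : ℝ) 1, f x * haarFun i x = 0) : f =ᵐ[mu] 0 := by
  have hI : IntervalIntegrable f volume 0 1 := intervalIntegrable_of_mem hf (by simp) (by simp)
  have hc : ContinuousOn (fun x => ∫ y in (0 : ℝ)..x, f y) (Icc 0 1) := by
    have := intervalIntegral.continuousOn_primitive_interval' hI (left_mem_uIcc)
    rwa [uIcc_of_le (zero_le_one (α := ℝ))] at this
  have hF : ∀ x ∈ Icc (0 : ℝ) 1, ∫ y in (0 : ℝ)..x, f y = 0 := by
    intro x hx
    have hmem : ∀ n : ℕ, ⌊x * 2 ^ n⌋₊ ≤ 2 ^ n := fun n =>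
      Nat.floor_le_of_le (by push_cast; exact mul_le_of_le_one_left (by positivity) hx.2)
    have hlim : Filter.Tendsto (fun n : ℕ => (⌊x * 2 ^ n⌋₊ : ℝ) / 2 ^ n) Filter.atTop
        (nhdsWithin x (Icc 0 1)) := by
      rw [tendsto_nhdsWithin_iff]
      refine ⟨(tendsto_nat_floor_mul_div_atTop hx.1).comp
        (tendsto_pow_atTop_atTop_of_one_lt one_lt_two), .of_forall fun n => ⟨by positivity, ?_⟩⟩
      rw [div_le_one (by positivity)]
      exact_mod_cast hmem n
    refine tendsto_nhds_unique ((hc x hx).tendsto.comp hlim) ?_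
    refine tendsto_const_nhds.congr fun n => ?_
    exact (primitive_dyadic_eq_zero hf h0 n (hmem n)).symm
  -- The two-sided derivative needs a neighbourhood of `x` inside `[0,1]`, so the endpoint `1` is
  -- discarded.
  have h1 : ∀ᵐ x : ℝ, x ≠ 1 := by simp [ae_iff]
  filter_upwards [ae_restrict_of_ae hI.ae_hasDerivAt_integral, ae_restrict_of_ae h1,
    ae_restrict_mem measurableSet_Ioc] with x hd hx1 hx
  have hd' := hd (by rw [uIcc_of_le zero_le_one]; exact Ioc_subset_Icc_self hx) 0 (by simp)
  have hev : (fun x => ∫ y in (0 : ℝ)..x, f y) =ᶠ[nhds x] fun _ => 0 := by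
    filter_upwards [Ioo_mem_nhds hx.1 (lt_of_le_of_ne hx.2 hx1)] with y hy
    exact hF y (Ioo_subset_Icc_self hy)
  exact hd'.unique ((hasDerivAt_const x (0 : ℂ)).congr_of_eventuallyEq hev)

theorem span_haarVec_orthogonal : (Submodule.span ℂ (range haarVec))ᗮ = ⊥ := by
  rw [Submodule.eq_bot_iff]
  intro f hf
  rw [Lp.eq_zero_iff_ae_eq_zero]
  refine ae_eq_zero_of_haar (Lp.memLp f).integrable_mu fun i => ?_
  rw [← inner_haarVec]
  exact Submodule.inner_right_of_mem_orthogonal (Submodule.subset_span (mem_range_self i)) hf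

/-- The Haar basis. -/
noncomputable def haarBasis : HilbertBasis HaarIndex ℂ L2 :=
  HilbertBasis.mkOfOrthogonalEqBot orthonormal_haarVec span_haarVec_orthogonal

theorem coe_haarBasis : ⇑haarBasis = haarVec :=
  HilbertBasis.coe_mkOfOrthogonalEqBot orthonormal_haarVec span_haarVec_orthogonal

theorem haarBasis_repr_apply (f : L2) (i : HaarIndex) :
    haarBasis.repr f i = inner ℂ (haarVec i) f := by
  rw [HilbertBasis.repr_apply_apply, coe_haarBasis]

theorem isHaarTransform_repr : IsHaarTransform haarBasis.repr := fun f i => by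
  rw [haarBasis_repr_apply, inner_haarVec]

theorem dense_span_haarVec : Dense (Submodule.span ℂ (range haarVec) : Set L2) := by
  rw [← coe_haarBasis]
  exact Submodule.dense_iff_topologicalClosure_eq_top.mpr haarBasis.dense_span

/-! ### Block diagonal operators -/

/-- `A` is given in the Haar basis by `[1] ⊕ ⨁ₙ M n`. -/
structure HasBlocks (A : L2 →L[ℂ] L2) (M : ∀ n : ℕ, Matrix (Fin (2 ^ n)) (Fin (2 ^ n)) ℂ) :
    Prop where
  map_gVec : A (gVec 0 0) = gVec 0 0
  map_hVec : ∀ (n : ℕ) (k : Fin (2 ^ n)), A (hVec n k) = ∑ j, M n j k • hVec n j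

theorem inner_hVec_hVec {n : ℕ} (j k : Fin (2 ^ n)) :
    inner ℂ (hVec n j) (hVec n k) = if j = k then (1 : ℂ) else 0 := by
  split_ifs with h
  · subst h; exact inner_haarVec_self (some ⟨n, j⟩)
  · exact inner_haarVec_of_ne (i := some ⟨n, j⟩) (j := some ⟨n, k⟩) (by simpa using h)

theorem inner_hVec_of_ne {n m : ℕ} (h : n ≠ m) (j : Fin (2 ^ n)) (k : Fin (2 ^ m)) :
    inner ℂ (hVec n j) (hVec m k) = 0 :=
  inner_haarVec_of_ne (i := some ⟨n, j⟩) (j := some ⟨m, k⟩) fun h' => h (by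
    injection h' with h'; exact congrArg Sigma.fst h')

theorem inner_gVec_hVec (n : ℕ) (k : Fin (2 ^ n)) : inner ℂ (gVec 0 0) (hVec n k) = 0 :=
  inner_haarVec_of_ne (i := none) (j := some ⟨n, k⟩) (by simp)

theorem inner_hVec_gVec (n : ℕ) (k : Fin (2 ^ n)) : inner ℂ (hVec n k) (gVec 0 0) = 0 :=
  inner_haarVec_of_ne (i := some ⟨n, k⟩) (j := none) (by simp)

namespace HasBlocks

variable {A A' : L2 →L[ℂ] L2} {M M' : ∀ n : ℕ, Matrix (Fin (2 ^ n)) (Fin (2 ^ n)) ℂ}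

theorem inner_same (h : HasBlocks A M) (n : ℕ) (j k : Fin (2 ^ n)) :
    inner ℂ (hVec n j) (A (hVec n k)) = M n j k := by
  simp [h.map_hVec, inner_sum, inner_smul_right, inner_hVec_hVec]

theorem inner_of_ne (h : HasBlocks A M) {n m : ℕ} (hnm : n ≠ m) (j : Fin (2 ^ n))
    (k : Fin (2 ^ m)) : inner ℂ (hVec n j) (A (hVec m k)) = 0 := by
  simp [h.map_hVec, inner_sum, inner_smul_right, inner_hVec_of_ne hnm]

theorem inner_gVec (h : HasBlocks A M) (n : ℕ) (k : Fin (2 ^ n)) :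
    inner ℂ (gVec 0 0) (A (hVec n k)) = 0 := by
  simp [h.map_hVec, inner_sum, inner_smul_right, inner_gVec_hVec]

theorem block_eq (h : HasBlocks A M) : block A = M := by
  funext n
  ext j k
  exact h.inner_same n j k

theorem map_V (h : HasBlocks A M) : (V 0).map (A : L2 →ₗ[ℂ] L2) = V 0 := by
  have hV : (range fun k : Fin (2 ^ 0) => gVec 0 k) = {gVec 0 0} := by
    let : Unique (Fin (2 ^ 0)) := inferInstanceAs (Unique (Fin 1))
    rw [range_unique]
    rfl
  rw [V, hV, Submodule.map_span, image_singleton]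
  exact congrArg (fun v => Submodule.span ℂ {v}) h.map_gVec

theorem map_W_le (h : HasBlocks A M) (n : ℕ) : (W n).map (A : L2 →ₗ[ℂ] L2) ≤ W n := by
  rw [W, Submodule.map_span, Submodule.span_le]
  rintro _ ⟨_, ⟨k, rfl⟩, rfl⟩
  change A (hVec n k) ∈ _
  rw [h.map_hVec]
  exact Submodule.sum_mem _ fun j _ =>
    Submodule.smul_mem _ _ (Submodule.subset_span (mem_range_self j))

/-- Each coordinate of either side is a continuous linear functional of `f`, because the rows of the
block matrix are finite. It therefore suffices to compare them on the Haar functions. -/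
theorem repr_apply (h : HasBlocks A M) (f : L2) :
    (haarBasis.repr (A f) : HaarIndex → ℂ) = blockSum M (haarBasis.repr f) := by
  funext i
  match i with
  | none =>
    have key : (innerSL ℂ (gVec 0 0)).comp A = innerSL ℂ (gVec 0 0) := by
      refine ContinuousLinearMap.ext_on dense_span_haarVec ?_
      rintro _ ⟨_ | ⟨m, l⟩, rfl⟩
      · change inner ℂ (gVec 0 0) (A (gVec 0 0)) = inner ℂ (gVec 0 0) (gVec 0 0)
        rw [h.map_gVec]
      · change inner ℂ (gVec 0 0) (A (hVec m l)) = inner ℂ (gVec 0 0) (hVec m l)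
        rw [h.inner_gVec, inner_gVec_hVec]
    rw [blockSum, haarBasis_repr_apply, haarBasis_repr_apply]
    exact DFunLike.congr_fun key f
  | some ⟨n, k⟩ =>
    have key : (innerSL ℂ (hVec n k)).comp A = ∑ j, M n k j • innerSL ℂ (hVec n j) := by
      refine ContinuousLinearMap.ext_on dense_span_haarVec ?_
      rintro _ ⟨_ | ⟨m, l⟩, rfl⟩
      · simp only [haarVec, ContinuousLinearMap.comp_apply, h.map_gVec, innerSL_apply_apply,
          sum_apply, smul_apply, inner_hVec_gVec, smul_zero,
          Finset.sum_const_zero]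
      · simp only [haarVec, ContinuousLinearMap.comp_apply, innerSL_apply_apply,
          sum_apply, smul_apply]
        by_cases hnm : n = m
        · subst hnm
          simp [h.inner_same, inner_hVec_hVec]
        · simp [h.inner_of_ne hnm, inner_hVec_of_ne hnm]
    have := DFunLike.congr_fun key f
    simp only [ContinuousLinearMap.comp_apply, innerSL_apply_apply,
      sum_apply, smul_apply] at this
    simp only [blockSum, Matrix.mulVec, dotProduct, haarBasis_repr_apply]
    exact this

/-- The block operator is taken to be the conjugate of `A` by the Haar transform, so its boundedness
needs no estimate on the blocks. -/
theorem exists_blockSum (h : HasBlocks A M) :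
    ∃ B : l2 →L[ℂ] l2, (∀ c : l2, (B c : HaarIndex → ℂ) = blockSum (block A) c) ∧
      ∀ f : L2, A f = haarBasis.repr.symm (B (haarBasis.repr f)) := by
  refine ⟨(haarBasis.repr.toContinuousLinearEquiv : L2 →L[ℂ] l2).comp
    (A.comp (haarBasis.repr.symm.toContinuousLinearEquiv : l2 →L[ℂ] L2)), fun c => ?_, fun f => ?_⟩
  · rw [h.block_eq]
    refine (h.repr_apply (haarBasis.repr.symm c)).trans ?_
    rw [LinearIsometryEquiv.apply_symm_apply]
  · simp

theorem adjoint_eq (h : HasBlocks A M) (h' : HasBlocks A' M')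
    (hM : ∀ n, (M n).conjTranspose = M' n) : ContinuousLinearMap.adjoint A = A' := by
  refine ContinuousLinearMap.ext_on dense_span_haarVec ?_
  rintro _ ⟨i, rfl⟩
  refine haarBasis.repr.injective (lp.ext (funext fun j => ?_))
  rw [haarBasis_repr_apply, haarBasis_repr_apply, ContinuousLinearMap.adjoint_inner_right,
    ← inner_conj_symm]
  match i, j with
  | none, none => simp [haarVec, h.map_gVec, h'.map_gVec]
  | none, some ⟨n, k⟩ => simp [haarVec, h.inner_gVec, h'.map_gVec, inner_hVec_gVec]
  | some ⟨n, k⟩, none => simp [haarVec, h'.inner_gVec, h.map_gVec, inner_hVec_gVec]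
  | some ⟨n, k⟩, some ⟨m, l⟩ =>
    simp only [haarVec]
    by_cases hnm : n = m
    · subst hnm
      rw [h.inner_same, h'.inner_same, ← hM]
      rfl
    · rw [h.inner_of_ne hnm, h'.inner_of_ne (Ne.symm hnm), map_zero]

end HasBlocks

/-! ### Adjoint blocks and construction of the operators -/

theorem conjTranspose_blockMatrix (a b : ℂ) (n : ℕ) :
    (blockMatrix a b n).conjTranspose = blockMatrix (star b) (star a) n := by
  induction n with
  | zero => simp [blockMatrix]
  | succ n ih =>
    simp only [blockMatrix, Matrix.conjTranspose_smul, Matrix.conjTranspose_reindex,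
      Matrix.fromBlocks_conjTranspose, ih, Matrix.conjTranspose_one]
    simp

/-- The formula holds almost everywhere for every square integrable representative. Choosing the
explicit Haar functions as representatives turns their pointwise identities into identities in
`L₂(0,1]`. -/
theorem exists_haarOp {a b : ℂ} (ha : ‖a‖ ≤ 1) (hb : ‖b‖ ≤ 1) (hab : a + b = 1) :
    ∃ A : L2 →L[ℂ] L2, HasBlocks A (blockMatrix a b) ∧ ∀ (f : ℝ → ℂ) (hf : MemLp f 2 mu),
      (∀ᵐ x ∂mu, Summable (periodTerm (offDiag a b) f x)) ∧
      ∀ᵐ x ∂mu, (A hf.toLp : ℝ → ℂ) x = haarOp a b f x := by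
  obtain ⟨E, hE⟩ := exists_period ha hb
  obtain ⟨I, hI⟩ := exists_integral continuous_const continuous_id
    (fun x _ => show (0 : ℝ) ∈ Icc (0 : ℝ) 1 by simp) (fun x hx => Ioc_subset_Icc_self hx)
  obtain ⟨J, hJ⟩ := exists_integral continuous_id continuous_const
    (fun x hx => Ioc_subset_Icc_self hx) (fun x _ => show (1 : ℝ) ∈ Icc (0 : ℝ) 1 by simp)
  have hA : ∀ (f : ℝ → ℂ) (hf : MemLp f 2 mu),
      ∀ᵐ x ∂mu, ((E + a • I + b • J) hf.toLp : ℝ → ℂ) x = haarOp a b f x := by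
    intro f hf
    simp only [add_apply, smul_apply]
    filter_upwards [(hE f hf).2, hI f hf, hJ f hf,
      Lp.coeFn_add (E hf.toLp + a • I hf.toLp) (b • J hf.toLp),
      Lp.coeFn_add (E hf.toLp) (a • I hf.toLp), Lp.coeFn_smul a (I hf.toLp),
      Lp.coeFn_smul b (J hf.toLp)] with x h1 h2 h3 h4 h5 h6 h7
    rw [h4, Pi.add_apply, h5, Pi.add_apply, h6, h7, Pi.smul_apply, Pi.smul_apply, h1, h2, h3]
    rfl
  refine ⟨E + a • I + b • J, ⟨?_, fun n k => ?_⟩, fun f hf => ⟨(hE f hf).1, hA f hf⟩⟩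
  · refine Lp.ext ?_
    filter_upwards [hA _ (memLp_Gfun 0 0), (memLp_Gfun 0 0).coeFn_toLp,
      ae_restrict_mem measurableSet_Ioc] with x h1 h2 hx
    rw [gVec, h1, h2, haarOp_congr a b (g := fun _ => 1) (fun y hy => by
      rw [Gfun_zero_zero, G_of_mem hy]) hx, haarOp_const_one ha hb hab hx, Gfun_zero_zero,
      G_of_mem hx]
  · refine Lp.ext ?_
    have hs : ∀ᵐ x ∂mu, ∀ j : Fin (2 ^ n), (blockMatrix a b n j k • hVec n j : L2) x
        = blockMatrix a b n j k * Hfun n j x := by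
      rw [ae_all_iff]
      intro j
      filter_upwards [Lp.coeFn_smul (blockMatrix a b n j k) (hVec n j),
        (memLp_Hfun n j).coeFn_toLp] with x h1 h2
      rw [h1, Pi.smul_apply, hVec, h2, smul_eq_mul]
    filter_upwards [hA _ (memLp_Hfun n k), hs, ae_restrict_mem measurableSet_Ioc,
      Lp.coeFn_fun_finsetSum Finset.univ fun j => blockMatrix a b n j k • hVec n j]
      with x h1 h2 hx h3
    rw [hVec, h1, h3, haarOp_Hfun ha hb hab n k hx]
    exact Finset.sum_congr rfl fun j _ => (h2 j).symm

end HaarQubit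

open HaarQubit
theorem theorem3p1 :
    ∃ (T : L2 ≃ₗᵢ[ℂ] l2) (Pm Pp : L2 →L[ℂ] L2),
      IsHaarTransform T ∧
      -- `Pm` and `Pp` are given by the formulas for `P₋` and `P₊`, on all of `L₂(0,1]`
      (∀ (f : ℝ → ℂ) (hf : MemLp f 2 mu),
        (∀ᵐ x ∂mu, Summable (periodTerm sigmaMinus f x)) ∧
        (∀ᵐ x ∂mu, (Pm hf.toLp : ℝ → ℂ) x = Pminus f x) ∧
        (∀ᵐ x ∂mu, Summable (periodTerm sigmaPlus f x)) ∧
        (∀ᵐ x ∂mu, (Pp hf.toLp : ℝ → ℂ) x = Pplus f x)) ∧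
      -- block structure of `P₋`
      (∃ B : l2 →L[ℂ] l2, (∀ c : l2, (B c : HaarIndex → ℂ) = blockSum (block Pm) c) ∧
        ∀ f : L2, Pm f = T.symm (B (T f))) ∧
      (V 0).map (Pm : L2 →ₗ[ℂ] L2) = V 0 ∧
      (∀ n, (W n).map (Pm : L2 →ₗ[ℂ] L2) ≤ W n) ∧
      -- recurrence for the blocks of `P₋`
      block Pm 0 = 0 ∧
      (∀ n, block Pm (n + 1) = (1 / 2 : ℂ) • Matrix.reindex (halves n) (halves n)
        (Matrix.fromBlocks (block Pm n) 1 0 (block Pm n))) ∧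
      -- block structure of `P₊`
      (∃ B : l2 →L[ℂ] l2, (∀ c : l2, (B c : HaarIndex → ℂ) = blockSum (block Pp) c) ∧
        ∀ f : L2, Pp f = T.symm (B (T f))) ∧
      (V 0).map (Pp : L2 →ₗ[ℂ] L2) = V 0 ∧
      (∀ n, (W n).map (Pp : L2 →ₗ[ℂ] L2) ≤ W n) ∧
      -- recurrence for the blocks of `P₊`
      block Pp 0 = 0 ∧
      (∀ n, block Pp (n + 1) = (1 / 2 : ℂ) • Matrix.reindex (halves n) (halves n)
        (Matrix.fromBlocks (block Pp n) 0 1 (block Pp n))) ∧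
      -- `P₋` and `P₊` are adjoints of each other
      ContinuousLinearMap.adjoint Pm = Pp ∧
      ContinuousLinearMap.adjoint Pp = Pm := by
  obtain ⟨Pm, hm, hmf⟩ := exists_haarOp (a := 1) (b := 0) (by simp) (by simp) (by simp)
  obtain ⟨Pp, hp, hpf⟩ := exists_haarOp (a := 0) (b := 1) (by simp) (by simp) (by simp)
  refine ⟨haarBasis.repr, Pm, Pp, isHaarTransform_repr, fun f hf => ?_, hm.exists_blockSum,
    hm.map_V, hm.map_W_le, ?_, fun n => ?_, hp.exists_blockSum, hp.map_V, hp.map_W_le, ?_,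
    fun n => ?_, hm.adjoint_eq hp fun n => ?_, hp.adjoint_eq hm fun n => ?_⟩
  · obtain ⟨h1, h2⟩ := hmf f hf
    obtain ⟨h3, h4⟩ := hpf f hf
    rw [haarOp_one_zero] at h2
    rw [haarOp_zero_one] at h4
    exact ⟨h1, h2, h3, h4⟩
  · rw [hm.block_eq, blockMatrix]
  · rw [hm.block_eq, blockMatrix, one_smul, zero_smul]
  · rw [hp.block_eq, blockMatrix]
  · rw [hp.block_eq, blockMatrix, one_smul, zero_smul]
  · rw [conjTranspose_blockMatrix, star_one, star_zero]
  · rw [conjTranspose_blockMatrix, star_one, star_zero]
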